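/- Let $A\in\mathbb{R}^{n\times n}$, $B\in\mathbb{R}^{n\times m}$, let $Q\in\mathbb{R}^{n\times n}$ and $R\in\mathbb{R}^{m\times m}$ be symmetric positive definite, and let $\mathcal{D}$ be a probability distribution on $\mathbb{R}^n$ with finite second moments. Write $\|Z\|$ for the largest and $\sigma_{\min}(Z)$ for the smallest singular value of a matrix $Z$, and assume $\mu:=\sigma_{\min}\big(\mathbb{E}_{x_0\sim\mathcal{D}}[x_0x_0^T]\big)>0$. For $W\in\mathbb{R}^{m\times n}$ let $$C(W)=\mathbb{E}_{x_0\sim\mathcal{D}}\Big[\sum_{t=0}^{\infty}x_t^T(Q+W^TRW)x_t\Big],\qquad x_{t+1}=Ax_t+Bu_t,\quad u_t=-Wx_t,$$ be the LQR cost, call $W$ stabilizing if the spectral radius of $A-BW$ is less than $1$, and let $$\delta(W)=\frac{\sigma_{\min}(Q)\,\mu}{4\,C(W)\,\|B\|\,(\|A-BW\|+1)}\qquad(\delta(W)=\infty\text{ if }B=0).$$ Let $W$ and $U$ be stabilizing with $\|U-W\|\le\delta(W)$. Then $C$ is twice continuously differentiable near $W$ and near $U$, and its Hessian satisfies $$\|\nabla^2C(W)-\nabla^2C(U)\|\le\rho(W)\,\|W-U\|,$$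 where the norm of a bilinear form $H$ on $\mathbb{R}^{m\times n}$ is $\|H\|=\sup\{|H[Y,Z]|:\|Y\|\le1,\ \|Z\|\le1\}$, and where, with $\gamma=\|B\|(\|A-BW\|+1)$, $$\rho(W)=\frac{64\,C(W)^2\gamma}{\mu\,\sigma_{\min}(Q)^2}\left(\|R\|+\|B\|^2\frac{C(W)}{\mu}+\frac{4\,C(W)\,\gamma}{\mu\,\sigma_{\min}(Q)}\left(\sqrt{\|R\|\frac{C(W)}{\mu}}+\|B\|\,\|A-BW\|\,\frac{C(W)}{\mu}\right)\right).$$ -/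

import Mathlib

open scoped Matrix
-- The norm of a real matrix is its largest singular value.
open scoped Matrix.Norms.L2Operator

namespace LQR

noncomputable section

/-- Spectral radius of a real square matrix (largest modulus of a complex eigenvalue). -/
def rad {n : ℕ} (Z : Matrix (Fin n) (Fin n) ℝ) : ENNReal :=
  spectralRadius ℂ (Z.map (algebraMap ℝ ℂ))

/-- Smallest singular value of a real square matrix. Singular values are listed in decreasing
order, starting at index `0`. -/
def sigmaMin {n : ℕ} (Z : Matrix (Fin n) (Fin n) ℝ) : ℝ :=
  (Matrix.toEuclideanLin Z).singularValues (n - 1)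

/-- `W` stabilizes the system `x (t + 1) = A x t + B u t`, `u t = - W x t`. -/
def Stabilizing {n m : ℕ} (A : Matrix (Fin n) (Fin n) ℝ) (B : Matrix (Fin n) (Fin m) ℝ)
    (W : Matrix (Fin m) (Fin n) ℝ) : Prop :=
  rad (A - B * W) < 1

/-- The state at time `t` from the initial state `x₀`, under the feedback `u t = - W x t`. -/
def state {n m : ℕ} (A : Matrix (Fin n) (Fin n) ℝ) (B : Matrix (Fin n) (Fin m) ℝ)
    (W : Matrix (Fin m) (Fin n) ℝ) (x₀ : Fin n → ℝ) : ℕ → Fin n → ℝ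
  | 0 => x₀
  | t + 1 => A *ᵥ state A B W x₀ t + B *ᵥ (-(W *ᵥ state A B W x₀ t))

/-- The LQR cost `C(W) = 𝔼 ∑ₜ xₜᵀ (Q + Wᵀ R W) xₜ`, with `x₀` distributed as `D`. -/
def cost {n m : ℕ} (A : Matrix (Fin n) (Fin n) ℝ) (B : Matrix (Fin n) (Fin m) ℝ)
    (Q : Matrix (Fin n) (Fin n) ℝ) (R : Matrix (Fin m) (Fin m) ℝ)
    (D : MeasureTheory.Measure (Fin n → ℝ)) (W : Matrix (Fin m) (Fin n) ℝ) : ℝ :=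
  ∫ x₀, ∑' t : ℕ, state A B W x₀ t ⬝ᵥ ((Q + Wᵀ * R * W) *ᵥ state A B W x₀ t) ∂D

/-- The second moment matrix `𝔼[x₀ x₀ᵀ]`. -/
def secondMoment {n : ℕ} (D : MeasureTheory.Measure (Fin n → ℝ)) : Matrix (Fin n) (Fin n) ℝ :=
  Matrix.of fun i j => ∫ x₀, x₀ i * x₀ j ∂D

/-- `μ = σ_min(𝔼[x₀ x₀ᵀ])`. -/
def mu {n : ℕ} (D : MeasureTheory.Measure (Fin n → ℝ)) : ℝ :=
  sigmaMin (secondMoment D)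

/-- The radius `δ(W) = σ_min(Q) μ / (4 C(W) ‖B‖ (‖A - B W‖ + 1))`
(to be read as `∞` if `B = 0`). -/
def delta {n m : ℕ} (A : Matrix (Fin n) (Fin n) ℝ) (B : Matrix (Fin n) (Fin m) ℝ)
    (Q : Matrix (Fin n) (Fin n) ℝ) (R : Matrix (Fin m) (Fin m) ℝ)
    (D : MeasureTheory.Measure (Fin n → ℝ)) (W : Matrix (Fin m) (Fin n) ℝ) : ℝ :=
  sigmaMin Q * mu D / (4 * cost A B Q R D W * ‖B‖ * (‖A - B * W‖ + 1))

/-- The Hessian of `f` at `w`: the second Fréchet derivative, as a bilinear form. For the space of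
matrices with the norm above, the norm of such a form `H` is the supremum of `|H Y Z|` over
matrices `Y`, `Z` with `‖Y‖ ≤ 1` and `‖Z‖ ≤ 1`. -/
def hessian {E : Type*} [NormedAddCommGroup E] [NormedSpace ℝ E] (f : E → ℝ) (w : E) :
    E →L[ℝ] E →L[ℝ] ℝ :=
  fderiv ℝ (fderiv ℝ f) w

/-- The Lipschitz constant `ρ` of the Hessian, as a function of real numbers
`c = C(W)`, `μ`, `s = σ_min(Q)`, `b = ‖B‖`, `r = ‖R‖`, `a = ‖A - B W‖`. -/
def rho (c μ s b r a : ℝ) : ℝ :=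
  64 * (c ^ 2 / (μ * s ^ 2)) * (b * (a + 1)) *
    (r + b ^ 2 * (c / μ) +
      4 * (c / (μ * s)) * (b * (a + 1)) * (Real.sqrt (r * (c / μ)) + b * a * (c / μ)))

end

end LQR

/-! With `F = A - BW` and `M = 𝔼[x₀x₀ᵀ]`, the cost is `tr (M P)`, where `P` solves the Lyapunov
equation `P = Q + WᵀRW + FᵀPF`. The solution operator `lyap` is the inverse of a linear map
depending smoothly on `F`, so `C` is smooth on the open set of stabilizing matrices. Differentiating
the equation twice gives the same equation with new sources. Moving the solution operator onto `M`
by trace duality turns the Hessian into `tr (Σ H[Y,Z])`, with `Σ` the state correlation and `H`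
explicit (`hessian_cost_apply`).

The Hessian difference is then estimated by perturbing `Σ` and `H`. Positivity bounds everything at
`W` by the cost `c`: `‖lyap Fᵀ‖ ≤ κ = c/(μs)`, `‖P‖ ≤ c/μ`, `tr Σ ≤ c/s`, where `s = σ_min(Q)`. The
radius `δ(W)` makes `4κ‖B‖(‖F‖+1)‖U-W‖ ≤ 1`, so a resolvent identity lets the solution operator at
most double between `W` and `U` (`norm_lyap_perturbed_le`). Sources are measured in operator norm
and `Σ` by duality with it (`abs_trace_lyap_perturbed_le`), so no dimension factor appears.
`abs_trace_hessSource_sub_le` assembles the estimate. -/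

namespace LQR

/-! ### Operator norm, trace and positive semidefinite matrices. -/

section LinearAlgebra

variable {ι κ : Type*} [Fintype ι] [Fintype κ]

theorem dotProduct_self_eq_norm_sq (x : ι → ℝ) : x ⬝ᵥ x = ‖WithLp.toLp 2 x‖ ^ 2 := by
  rw [EuclideanSpace.real_norm_sq_eq]
  simp [dotProduct, sq]

theorem dotProduct_le_norm_mul_norm (x y : ι → ℝ) :
    |x ⬝ᵥ y| ≤ ‖WithLp.toLp 2 x‖ * ‖WithLp.toLp 2 y‖ := by
  have h := abs_real_inner_le_norm (WithLp.toLp 2 y) (WithLp.toLp 2 x)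
  rw [EuclideanSpace.inner_toLp_toLp] at h
  simpa [mul_comm] using h

variable [DecidableEq κ]

theorem norm_transpose [DecidableEq ι] (M : Matrix ι κ ℝ) : ‖Mᵀ‖ = ‖M‖ := by
  rw [← Matrix.conjTranspose_eq_transpose_of_trivial, Matrix.l2_opNorm_conjTranspose]

theorem norm_mul_le_of_le {l : Type*} [Fintype l] [DecidableEq l] {M : Matrix ι κ ℝ}
    {N : Matrix κ l ℝ} {c d : ℝ} (hM : ‖M‖ ≤ c) (hN : ‖N‖ ≤ d) : ‖M * N‖ ≤ c * d :=
  (Matrix.l2_opNorm_mul M N).trans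
    (mul_le_mul hM hN (norm_nonneg _) ((norm_nonneg _).trans hM))

theorem norm_mul_transpose_self (M : Matrix ι κ ℝ) : ‖Mᵀ * M‖ = ‖M‖ * ‖M‖ := by
  rw [← Matrix.conjTranspose_eq_transpose_of_trivial, Matrix.l2_opNorm_conjTranspose_mul_self]

/-- The arithmetic mean replaces the product of norms because it is additive in the two quadratic
forms, hence can be summed termwise along a Lyapunov series. -/
theorem abs_dotProduct_mulVec_le (M : Matrix ι κ ℝ) (x : ι → ℝ) (y : κ → ℝ) :
    |x ⬝ᵥ M *ᵥ y| ≤ ‖M‖ * ((x ⬝ᵥ x + y ⬝ᵥ y) / 2) := by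
  have h1 := dotProduct_le_norm_mul_norm x (M *ᵥ y)
  have h2 := Matrix.l2_opNorm_mulVec M (WithLp.toLp 2 y)
  simp only at h2
  rw [dotProduct_self_eq_norm_sq, dotProduct_self_eq_norm_sq]
  have h3 := mul_le_mul_of_nonneg_left h2 (norm_nonneg (WithLp.toLp 2 x))
  have h4 := mul_nonneg (norm_nonneg M)
    (sq_nonneg (‖WithLp.toLp 2 x‖ - ‖WithLp.toLp 2 y‖))
  refine (h1.trans h3).trans ?_
  linarith

theorem norm_le_of_abs_dotProduct_mulVec_le {M : Matrix ι κ ℝ} {c : ℝ} (hc : 0 ≤ c)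
    (h : ∀ x y, |x ⬝ᵥ M *ᵥ y| ≤ c * ((x ⬝ᵥ x + y ⬝ᵥ y) / 2)) : ‖M‖ ≤ c := by
  rw [Matrix.l2_opNorm_def]
  refine ContinuousLinearMap.opNorm_le_bound _ hc fun y => ?_
  change ‖WithLp.toLp 2 (M *ᵥ y.ofLp)‖ ≤ _
  set z := M *ᵥ y.ofLp with hz
  rcases (norm_nonneg (WithLp.toLp 2 z)).eq_or_lt with h0 | h0
  · rw [← h0]; positivity
  rcases (norm_nonneg y).eq_or_lt with h1 | h1
  · have : y = 0 := norm_eq_zero.mp h1.symm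
    simp [hz, this] at h0
  -- Rescaling `z` to the length of `y` makes the arithmetic mean equal to `‖y‖²`, so nothing is
  -- lost.
  have h2 := h ((‖y‖ / ‖WithLp.toLp 2 z‖) • z) y.ofLp
  rw [← hz, smul_dotProduct, dotProduct_smul, smul_dotProduct, dotProduct_self_eq_norm_sq z,
    dotProduct_self_eq_norm_sq y.ofLp] at h2
  simp only [WithLp.toLp_ofLp, smul_eq_mul] at h2
  rw [abs_of_nonneg (by positivity)] at h2
  field_simp at h2
  nlinarith

variable [DecidableEq ι]

theorem exists_eq_transpose_mul_self {S : Matrix ι ι ℝ} (hS : S.PosSemidef) :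
    ∃ L : Matrix ι ι ℝ, S = Lᵀ * L := by
  open scoped MatrixOrder in
  obtain ⟨L, hL⟩ := CStarAlgebra.nonneg_iff_eq_star_mul_self.mp hS.nonneg
  exact ⟨L, by rw [hL, Matrix.star_eq_conjTranspose,
    Matrix.conjTranspose_eq_transpose_of_trivial]⟩

/-- Duality of operator and trace norms: with `S = LᵀL`, the trace is a sum of quadratic forms of
`M` at the rows of `L`. -/
theorem abs_trace_mul_le (M : Matrix ι ι ℝ) {S : Matrix ι ι ℝ} (hS : S.PosSemidef) :
    |(M * S).trace| ≤ ‖M‖ * S.trace := by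
  obtain ⟨L, rfl⟩ := exists_eq_transpose_mul_self hS
  have h1 : (M * (Lᵀ * L)).trace = ∑ i, L i ⬝ᵥ M *ᵥ L i := by
    rw [← Matrix.mul_assoc, Matrix.trace_mul_comm]
    refine Finset.sum_congr rfl fun i _ => ?_
    rfl
  have h2 : (Lᵀ * L).trace = ∑ i, L i ⬝ᵥ L i := by
    rw [Matrix.trace_mul_comm]
    rfl
  rw [h1, h2, Finset.mul_sum]
  refine (Finset.abs_sum_le_sum_abs _ _).trans (Finset.sum_le_sum fun i _ => ?_)
  have := abs_dotProduct_mulVec_le M (L i) (L i)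
  rwa [add_self_div_two] at this

theorem trace_mul_nonneg {S T : Matrix ι ι ℝ} (hS : S.PosSemidef) (hT : T.PosSemidef) :
    0 ≤ (S * T).trace := by
  obtain ⟨L, rfl⟩ := exists_eq_transpose_mul_self hT
  rw [← Matrix.mul_assoc, Matrix.trace_mul_comm, ← Matrix.mul_assoc]
  have := hS.mul_mul_conjTranspose_same L
  rw [Matrix.conjTranspose_eq_transpose_of_trivial] at this
  exact this.trace_nonneg

theorem norm_le_trace {S : Matrix ι ι ℝ} (hS : S.PosSemidef) : ‖S‖ ≤ S.trace := by
  refine norm_le_of_abs_dotProduct_mulVec_le hS.trace_nonneg fun x y => ?_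
  have key : ∀ z : ι → ℝ, z ⬝ᵥ S *ᵥ z ≤ S.trace * (z ⬝ᵥ z) := by
    intro z
    obtain ⟨L, rfl⟩ := exists_eq_transpose_mul_self hS
    have h2 : (Lᵀ * L).trace = ∑ i, L i ⬝ᵥ L i := by
      rw [Matrix.trace_mul_comm]
      rfl
    rw [h2, ← Matrix.mulVec_mulVec, Matrix.dotProduct_mulVec, Matrix.vecMul_transpose,
      Finset.sum_mul, dotProduct]
    refine Finset.sum_le_sum fun i _ => ?_
    have h3 := dotProduct_le_norm_mul_norm (L i) z
    rw [dotProduct_self_eq_norm_sq, dotProduct_self_eq_norm_sq, ← mul_pow, ← sq]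
    exact sq_le_sq.mpr (h3.trans (le_abs_self _))
  have hx := key x
  have hy := key y
  -- Nonnegativity at `x ± y` bounds the mixed term by the mean of the two diagonal ones.
  have h1 := hS.dotProduct_mulVec_nonneg (x + y)
  have h2 := hS.dotProduct_mulVec_nonneg (x - y)
  have hsym : y ⬝ᵥ S *ᵥ x = x ⬝ᵥ S *ᵥ y := by
    rw [Matrix.dotProduct_mulVec, dotProduct_comm, ← Matrix.mulVec_transpose,
      ← Matrix.conjTranspose_eq_transpose_of_trivial, hS.isHermitian]
  simp only [star_trivial, Matrix.mulVec_add, Matrix.mulVec_sub, dotProduct_add, dotProduct_sub,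
    add_dotProduct, sub_dotProduct, hsym] at h1 h2
  rw [abs_le]
  constructor <;> linarith

/-- For `R = LᵀL`, `‖RW‖ ≤ ‖L‖ ‖LW‖`, and the C⋆-identity computes both squares. This is the source
of the square root in `rho`. -/
theorem norm_mul_sq_le {R : Matrix ι ι ℝ} (hR : R.PosSemidef) (W : Matrix ι κ ℝ) :
    ‖R * W‖ ^ 2 ≤ ‖R‖ * ‖Wᵀ * R * W‖ := by
  obtain ⟨L, rfl⟩ := exists_eq_transpose_mul_self hR
  have h1 : Wᵀ * (Lᵀ * L) * W = (L * W)ᵀ * (L * W) := by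
    simp only [Matrix.transpose_mul, Matrix.mul_assoc]
  rw [h1, norm_mul_transpose_self, norm_mul_transpose_self, Matrix.mul_assoc]
  have h2 : ‖Lᵀ * (L * W)‖ ≤ ‖L‖ * ‖L * W‖ := norm_mul_le_of_le (norm_transpose L).le le_rfl
  calc _ ≤ (‖L‖ * ‖L * W‖) ^ 2 := by gcongr
    _ = _ := by ring

end LinearAlgebra

/-! ### The smallest singular value as a lower spectral bound. -/

section SigmaMin

variable {n : ℕ}

/-- An eigenvalue `t` of the difference gives the eigenvalue `t + σ ≥ 0` of `Z`. Its square is an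
eigenvalue of `ZᵀZ`, hence a squared singular value, so `t + σ ≥ σ`. -/
theorem posSemidef_sub_sigmaMin {Z : Matrix (Fin n) (Fin n) ℝ} (hZ : Z.PosSemidef) :
    (Z - sigmaMin Z • (1 : Matrix (Fin n) (Fin n) ℝ)).PosSemidef := by
  rw [Matrix.posSemidef_iff_isHermitian_and_spectrum_nonneg]
  refine ⟨hZ.isHermitian.sub (Matrix.isHermitian_one.smul (IsSelfAdjoint.all _)), fun t ht => ?_⟩
  rw [← Matrix.spectrum_toLin', ← Module.End.hasEigenvalue_iff_mem_spectrum] at ht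
  obtain ⟨v, hv⟩ := ht.exists_hasEigenvector
  have hv0 : v ≠ 0 := hv.2
  have hn : 0 < n := by
    rcases Nat.eq_zero_or_pos n with rfl | h
    · exact absurd (Subsingleton.elim v 0) hv0
    · exact h
  have h1 := hv.apply_eq_smul
  rw [Matrix.toLin'_apply, Matrix.sub_mulVec, Matrix.smul_mulVec, Matrix.one_mulVec,
    sub_eq_iff_eq_add, ← add_smul] at h1
  set σ := sigmaMin Z with hσ
  have hσ0 : 0 ≤ σ := LinearMap.singularValues_nonneg _ _
  have hvv : 0 < v ⬝ᵥ v := by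
    simpa using Matrix.dotProduct_star_self_pos_iff (v := v) |>.mpr hv0
  have h2 : 0 ≤ t + σ := by
    have := hZ.dotProduct_mulVec_nonneg v
    rw [h1, star_trivial, dotProduct_smul, smul_eq_mul] at this
    exact nonneg_of_mul_nonneg_left this hvv
  set T := Matrix.toEuclideanLin Z with hT
  have hTv : T (WithLp.toLp 2 v) = (t + σ) • WithLp.toLp 2 v := by
    rw [hT, Matrix.toLpLin_toLp, Matrix.toLin'_apply, h1]
    rfl
  have hadj : LinearMap.adjoint T = T := by
    rw [hT, ← Matrix.toEuclideanLin_conjTranspose_eq_adjoint, hZ.isHermitian]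
  have hev : Module.End.HasEigenvalue (LinearMap.adjoint T ∘ₗ T) ((t + σ) ^ 2) := by
    refine Module.End.hasEigenvalue_of_hasEigenvector (x := WithLp.toLp 2 v) ⟨?_, ?_⟩
    · rw [Module.End.mem_eigenspace_iff, LinearMap.comp_apply, hadj, hTv, map_smul, hTv, smul_smul,
        sq]
    · simpa using hv0
  have hfr : Module.finrank ℝ (EuclideanSpace ℝ (Fin n)) = n := by simp
  obtain ⟨i, hi⟩ := T.isSymmetric_adjoint_comp_self.exists_eigenvalues_eq hfr hev
  have h3 : σ ^ 2 ≤ (t + σ) ^ 2 := by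
    have hi' : T.isSymmetric_adjoint_comp_self.eigenvalues hfr i = (t + σ) ^ 2 := by
      simpa using hi
    rw [← hi', ← T.sq_singularValues_fin hfr]
    have : σ ≤ T.singularValues i := T.singularValues_antitone (by omega)
    gcongr
  have h4 := abs_le_of_sq_le_sq' h3 h2
  change 0 ≤ t
  linarith [h4.2]

theorem sigmaMin_pos (hn : 0 < n) {Z : Matrix (Fin n) (Fin n) ℝ} (hZ : Z.PosDef) :
    0 < sigmaMin Z := by
  have h : Function.Injective (Matrix.toEuclideanLin Z) := by
    rw [injective_iff_map_eq_zero]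
    intro x hx
    by_contra h0
    have h1 := hZ.dotProduct_mulVec_pos (x := x.ofLp) (by simpa using h0)
    have h2 : Z *ᵥ x.ofLp = 0 := by
      have := congrArg WithLp.ofLp hx
      simpa using this
    simp [h2] at h1
  rw [LinearMap.injective_iff_forall_lt_finrank_singularValues_pos] at h
  exact h (n - 1) (by simp; omega)

end SigmaMin

/-! ### Spectral radius less than one: summable powers and openness. -/

section Stability

open Filter Topology

variable {n : ℕ}

/-- Gelfand's formula gives geometric decay of the complexified powers; entrywise real part is a
bounded linear map back to the real ones. -/
theorem summable_norm_pow_of_rad_lt_one {F : Matrix (Fin n) (Fin n) ℝ} (hF : rad F < 1) :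
    Summable fun t : ℕ => ‖F ^ t‖ := by
  set G : Matrix (Fin n) (Fin n) ℂ := F.map (algebraMap ℝ ℂ) with hG
  have hGt := spectrum.pow_nnnorm_pow_one_div_tendsto_nhds_spectralRadius G
  obtain ⟨r, hr1, hr2⟩ := ENNReal.lt_iff_exists_nnreal_btwn.mp (show spectralRadius ℂ G < 1 from hF)
  have hr2' : r < 1 := by exact_mod_cast hr2
  have hev : ∀ᶠ t : ℕ in atTop, ‖‖G ^ t‖‖ ≤ (r : ℝ) ^ t := by
    filter_upwards [hGt.eventually_lt_const hr1, eventually_gt_atTop 0] with t ht ht0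
    rw [one_div, ENNReal.rpow_inv_lt_iff (by exact_mod_cast ht0), ENNReal.rpow_natCast] at ht
    rw [norm_norm]
    have : ‖G ^ t‖₊ < r ^ t := by exact_mod_cast ht
    exact_mod_cast this.le
  have hsum : Summable fun t : ℕ => ‖G ^ t‖ :=
    Summable.of_norm_bounded_eventually_nat
      (summable_geometric_of_lt_one r.coe_nonneg (by exact_mod_cast hr2')) hev
  let re : Matrix (Fin n) (Fin n) ℂ →ₗ[ℝ] Matrix (Fin n) (Fin n) ℝ :=
    Complex.reLm.mapMatrix
  have hre : ∀ t, F ^ t = LinearMap.toContinuousLinearMap re (G ^ t) := by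
    intro t
    have : G ^ t = (F ^ t).map (algebraMap ℝ ℂ) := by
      rw [hG]
      exact (map_pow (algebraMap ℝ ℂ).mapMatrix F t).symm
    rw [this]
    ext i j
    simp [re]
  refine Summable.of_nonneg_of_le (fun _ => norm_nonneg _) (fun t => ?_)
    (hsum.mul_left ‖LinearMap.toContinuousLinearMap re‖)
  rw [hre]
  exact ContinuousLinearMap.le_opNorm _ _

/-- By Gelfand's formula some power has norm below one. That condition is open, and it forces
spectral radius below one. -/
theorem eventually_rad_lt_one {X : Type*} [TopologicalSpace X] {f : X → Matrix (Fin n) (Fin n) ℝ}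
    {x : X} (hf : ContinuousAt f x) (h : rad (f x) < 1) : ∀ᶠ y in 𝓝 x, rad (f y) < 1 := by
  rcases Nat.eq_zero_or_pos n with rfl | hn
  · refine Eventually.of_forall fun y => ?_
    rw [rad, spectrum.SpectralRadius.of_subsingleton]
    exact zero_lt_one
  have : Nonempty (Fin n) := ⟨⟨0, hn⟩⟩
  let G : X → Matrix (Fin n) (Fin n) ℂ := fun y => (f y).map (algebraMap ℝ ℂ)
  have hGt := spectrum.pow_nnnorm_pow_one_div_tendsto_nhds_spectralRadius (G x)
  obtain ⟨k, hk, hk0⟩ := ((hGt.eventually_lt_const h).and (eventually_gt_atTop 0)).exists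
  rw [one_div, ENNReal.rpow_inv_lt_iff (by exact_mod_cast hk0), ENNReal.one_rpow] at hk
  have hG : ContinuousAt G x := by
    have : Continuous fun M : Matrix (Fin n) (Fin n) ℝ => M.map (algebraMap ℝ ℂ) :=
      continuous_id.matrix_map (by exact Complex.continuous_ofReal)
    exact this.continuousAt.comp hf
  have hGk : Tendsto (fun y => (‖G y ^ k‖₊ : ENNReal)) (𝓝 x) (𝓝 ‖G x ^ k‖₊) :=
    ENNReal.tendsto_coe.mpr (hG.pow k).nnnorm
  filter_upwards [hGk.eventually_lt_const hk] with y hy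
  have h1 : spectralRadius ℂ (G y) ^ k < 1 :=
    ((spectrum.spectralRadius_pow_le (G y) k hk0.ne').trans
      (spectrum.spectralRadius_le_nnnorm _)).trans_lt hy
  by_contra hcon
  exact absurd h1 (not_lt.mpr (one_le_pow₀ (not_lt.mp hcon)))

end Stability

/-! ### The equation `X = S + F X G` in a Banach algebra. -/

section SteinEquation

variable {𝔸 : Type*} [NormedRing 𝔸] [NormedAlgebra ℝ 𝔸]

/-- Summability of the norms of the powers of an element of a normed ring. -/
def PowSummable {𝔸 : Type*} [NormedRing 𝔸] (F : 𝔸) : Prop := Summable fun t : ℕ => ‖F ^ t‖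

/-- If the powers of `F` and `G` are summable, then `stein F G S` is the solution `X` of the
equation `X = S + F X G`. -/
noncomputable def stein (F G : 𝔸) : 𝔸 →L[ℝ] 𝔸 :=
  Ring.inverse (1 - ContinuousLinearMap.mulLeftRight ℝ 𝔸 F G)

theorem mulLeftRight_pow_apply (F G X : 𝔸) (t : ℕ) :
    (ContinuousLinearMap.mulLeftRight ℝ 𝔸 F G ^ t) X = F ^ t * X * G ^ t := by
  induction t generalizing X with
  | zero => simp
  | succ t ih =>
    rw [pow_succ, mul_apply_eq_comp, ih, ContinuousLinearMap.mulLeftRight_apply, pow_succ,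
      pow_succ' G]
    simp only [mul_assoc]

variable [CompleteSpace 𝔸] {F G : 𝔸}

/-- The powers are `X ↦ Fᵗ X Gᵗ`, and `‖Gᵗ‖ ≤ 1` eventually. Thus the Neumann series inverts `1 -
mulLeftRight F G`. -/
theorem PowSummable.mulLeftRight (hF : PowSummable F) (hG : PowSummable G) :
    Summable fun t : ℕ => ContinuousLinearMap.mulLeftRight ℝ 𝔸 F G ^ t := by
  refine Summable.of_norm_bounded_eventually_nat hF ?_
  filter_upwards [hG.tendsto_atTop_zero.eventually_le_const zero_lt_one] with t ht
  refine ContinuousLinearMap.opNorm_le_bound _ (norm_nonneg _) fun X => ?_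
  rw [mulLeftRight_pow_apply]
  calc _ ≤ ‖F ^ t * X‖ * ‖G ^ t‖ := norm_mul_le _ _
    _ ≤ ‖F ^ t * X‖ * 1 := by gcongr
    _ ≤ ‖F ^ t‖ * ‖X‖ := by rw [mul_one]; exact norm_mul_le _ _

theorem PowSummable.isUnit_one_sub_mulLeftRight (hF : PowSummable F) (hG : PowSummable G) :
    IsUnit (1 - ContinuousLinearMap.mulLeftRight ℝ 𝔸 F G) :=
  ⟨⟨1 - ContinuousLinearMap.mulLeftRight ℝ 𝔸 F G, _, (hF.mulLeftRight hG).one_sub_mul_tsum_pow,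
    (hF.mulLeftRight hG).tsum_pow_mul_one_sub⟩, rfl⟩

theorem stein_eq (hF : PowSummable F) (hG : PowSummable G) (S : 𝔸) :
    stein F G S = S + F * stein F G S * G := by
  have h := congrArg (fun T => T S)
    (Ring.mul_inverse_cancel _ (hF.isUnit_one_sub_mulLeftRight hG))
  simp only [mul_apply_eq_comp, sub_apply, one_apply_eq_self] at h
  exact sub_eq_iff_eq_add.mp h

theorem stein_unique (hF : PowSummable F) (hG : PowSummable G) {S X : 𝔸}
    (hX : X = S + F * X * G) : X = stein F G S := by
  have h := congrArg (fun T => T X)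
    (Ring.inverse_mul_cancel _ (hF.isUnit_one_sub_mulLeftRight hG))
  simp only [mul_apply_eq_comp, sub_apply, one_apply_eq_self] at h
  have h2 : X - ContinuousLinearMap.mulLeftRight ℝ 𝔸 F G X = S := by
    rw [ContinuousLinearMap.mulLeftRight_apply, sub_eq_iff_eq_add]; exact hX
  rw [h2] at h
  exact h.symm

theorem hasSum_stein (hF : PowSummable F) (hG : PowSummable G) (S : 𝔸) :
    HasSum (fun t : ℕ => F ^ t * S * G ^ t) (stein F G S) := by
  have h1 : stein F G = ∑' t : ℕ, ContinuousLinearMap.mulLeftRight ℝ 𝔸 F G ^ t :=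
    left_inv_eq_right_inv (Ring.inverse_mul_cancel _ (hF.isUnit_one_sub_mulLeftRight hG))
      (hF.mulLeftRight hG).one_sub_mul_tsum_pow
  have h2 := (ContinuousLinearMap.apply ℝ _ S).hasSum (hF.mulLeftRight hG).hasSum
  rw [h1]
  simpa only [ContinuousLinearMap.apply_apply, mulLeftRight_pow_apply] using h2

theorem hasDerivAt_ringInverse {f : ℝ → 𝔸} {f' : 𝔸} {s : ℝ} (hf : HasDerivAt f f' s)
    (hs : IsUnit (f s)) :
    HasDerivAt (fun u => Ring.inverse (f u))
      (-(Ring.inverse (f s) * f' * Ring.inverse (f s))) s := by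
  obtain ⟨u, hu⟩ := hs
  have hi := hasFDerivAt_ringInverse (𝕜 := ℝ) u
  rw [hu] at hi
  refine (hi.comp_hasDerivAt s hf).congr_deriv ?_
  simp only [neg_apply, ContinuousLinearMap.mulLeftRight_apply, ← hu, Ring.inverse_unit]

/-- Differentiating `X = S + F X G` shows that `X'` solves the same equation with source `S' + F' X
G + F X G'`. -/
theorem hasDerivAt_stein {f g S : ℝ → 𝔸} {f' g' S' : 𝔸} {s : ℝ} (hfs : PowSummable (f s))
    (hgs : PowSummable (g s)) (hf : HasDerivAt f f' s) (hg : HasDerivAt g g' s)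
    (hS : HasDerivAt S S' s) :
    HasDerivAt (fun u => stein (f u) (g u) (S u))
      (stein (f s) (g s) (S' + (f' * stein (f s) (g s) (S s) * g s +
        f s * stein (f s) (g s) (S s) * g'))) s := by
  have hc := (ContinuousLinearMap.mulLeftRight ℝ 𝔸).hasDerivAt_of_bilinear
    (fun _ => hf) (fun _ => hg)
  have hl := (hasDerivAt_ringInverse (hc.const_sub 1)
    (hfs.isUnit_one_sub_mulLeftRight hgs)).clm_apply hS
  refine hl.congr_deriv ?_
  have hr : Ring.inverse (1 - ContinuousLinearMap.mulLeftRight ℝ 𝔸 (f s) (g s)) =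
    stein (f s) (g s) := rfl
  rw [hr]
  simp only [ContinuousLinearMap.mulLeftRight_apply, mul_apply_eq_comp, add_apply, mul_neg, neg_mul,
    neg_neg, map_add]
  abel

theorem contDiffAt_stein {E : Type*} [NormedAddCommGroup E] [NormedSpace ℝ E]
    {f g S : E → 𝔸} {w : E} {k : WithTop ℕ∞} (hfw : PowSummable (f w)) (hgw : PowSummable (g w))
    (hf : ContDiffAt ℝ k f w) (hg : ContDiffAt ℝ k g w) (hS : ContDiffAt ℝ k S w) :
    ContDiffAt ℝ k (fun u => stein (f u) (g u) (S u)) w := by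
  have hc1 : ContDiffAt ℝ k (fun u => ContinuousLinearMap.mulLeftRight ℝ 𝔸 (f u)) w :=
    (ContinuousLinearMap.contDiff _).contDiffAt.comp w hf
  have hc : ContDiffAt ℝ k (fun u => ContinuousLinearMap.mulLeftRight ℝ 𝔸 (f u) (g u)) w :=
    hc1.clm_apply hg
  obtain ⟨u, hu⟩ := hfw.isUnit_one_sub_mulLeftRight hgw
  have hi : ContDiffAt ℝ k Ring.inverse
      (1 - ContinuousLinearMap.mulLeftRight ℝ 𝔸 (f w) (g w)) := by
    rw [← hu]
    exact contDiffAt_ringInverse ℝ u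
  exact (hi.comp w (contDiffAt_const.sub hc)).clm_apply hS

end SteinEquation

/-! ### The Lyapunov operator: duality, positivity, resolvent identity. -/

section Lyapunov

open Filter Topology

variable {n : ℕ}

/-- The type of continuous linear endomorphisms of a real normed space. -/
abbrev EndCLM (E : Type*) [NormedAddCommGroup E] [NormedSpace ℝ E] : Type _ := E →L[ℝ] E

/-- For stable `F`, `lyap F S` is the solution `X` of the Lyapunov equation
`X = S + F X Fᵀ`. -/
noncomputable def lyap (F : Matrix (Fin n) (Fin n) ℝ) : EndCLM (Matrix (Fin n) (Fin n) ℝ) :=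
  stein F Fᵀ

variable {F : Matrix (Fin n) (Fin n) ℝ}

theorem PowSummable.transpose (hF : PowSummable F) : PowSummable Fᵀ := by
  unfold PowSummable at hF ⊢
  simpa only [← Matrix.transpose_pow, norm_transpose] using hF

theorem lyap_eq (hF : PowSummable F) (S : Matrix (Fin n) (Fin n) ℝ) :
    lyap F S = S + F * lyap F S * Fᵀ :=
  stein_eq hF hF.transpose S

theorem lyap_unique (hF : PowSummable F) {S X : Matrix (Fin n) (Fin n) ℝ}
    (hX : X = S + F * X * Fᵀ) : X = lyap F S :=
  stein_unique hF hF.transpose hX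

theorem hasSum_lyap (hF : PowSummable F) (S : Matrix (Fin n) (Fin n) ℝ) :
    HasSum (fun t : ℕ => F ^ t * S * (F ^ t)ᵀ) (lyap F S) := by
  have h := hasSum_stein hF hF.transpose S
  simp only [← Matrix.transpose_pow] at h
  exact h

theorem lyap_transpose (hF : PowSummable F) (S : Matrix (Fin n) (Fin n) ℝ) :
    (lyap F S)ᵀ = lyap F Sᵀ := by
  refine lyap_unique hF ?_
  conv_lhs => rw [lyap_eq hF S]
  simp only [Matrix.transpose_add, Matrix.transpose_mul, Matrix.transpose_transpose,
    Matrix.mul_assoc]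

/-- `lyap F` and `lyap Fᵀ` are adjoint for the trace pairing: their inverses `a ↦ a - F a Fᵀ` and `b
↦ b - Fᵀ b F` are, by cyclicity. -/
theorem trace_lyap_mul (hF : PowSummable F) (X Y : Matrix (Fin n) (Fin n) ℝ) :
    (lyap F X * Y).trace = (X * lyap Fᵀ Y).trace := by
  have hX := lyap_eq hF X
  have hY := lyap_eq hF.transpose Y
  set a := lyap F X
  set b := lyap Fᵀ Y
  rw [Matrix.transpose_transpose] at hY
  have hX' : X = a - F * a * Fᵀ := by rw [eq_sub_iff_add_eq]; exact hX.symm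
  have hY' : Y = b - Fᵀ * b * F := by rw [eq_sub_iff_add_eq]; exact hY.symm
  rw [hX', hY', Matrix.mul_sub, Matrix.sub_mul, Matrix.trace_sub, Matrix.trace_sub]
  congr 1
  rw [Matrix.mul_assoc F, Matrix.mul_assoc F, Matrix.trace_mul_comm F]
  simp only [Matrix.mul_assoc]

theorem dotProduct_lyap_mulVec (hF : PowSummable F) (S : Matrix (Fin n) (Fin n) ℝ)
    (x y : Fin n → ℝ) :
    HasSum (fun t : ℕ => ((F ^ t)ᵀ *ᵥ x) ⬝ᵥ S *ᵥ ((F ^ t)ᵀ *ᵥ y)) (x ⬝ᵥ lyap F S *ᵥ y) := by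
  let φ : Matrix (Fin n) (Fin n) ℝ →ₗ[ℝ] ℝ :=
    { toFun := fun M => x ⬝ᵥ M *ᵥ y
      map_add' := fun M N => by rw [Matrix.add_mulVec, dotProduct_add]
      map_smul' := fun c M => by rw [Matrix.smul_mulVec, dotProduct_smul]; rfl }
  have h := (LinearMap.toContinuousLinearMap φ).hasSum (hasSum_lyap hF S)
  convert! h using 2 with t
  simp only [φ, LinearMap.coe_toContinuousLinearMap', LinearMap.coe_mk, AddHom.coe_mk]
  rw [← Matrix.mulVec_mulVec, ← Matrix.mulVec_mulVec, Matrix.dotProduct_mulVec x,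
    Matrix.mulVec_transpose]

theorem posSemidef_lyap (hF : PowSummable F) {S : Matrix (Fin n) (Fin n) ℝ} (hS : S.PosSemidef) :
    (lyap F S).PosSemidef := by
  refine Matrix.PosSemidef.of_dotProduct_mulVec_nonneg ?_ fun x => ?_
  · rw [Matrix.IsHermitian, Matrix.conjTranspose_eq_transpose_of_trivial, lyap_transpose hF,
      ← Matrix.conjTranspose_eq_transpose_of_trivial, hS.isHermitian]
  · rw [star_trivial]
    refine (dotProduct_lyap_mulVec hF S x x).nonneg fun t => ?_
    simpa using hS.dotProduct_mulVec_nonneg ((F ^ t)ᵀ *ᵥ x)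

theorem posSemidef_lyap_sub (hF : PowSummable F) {S : Matrix (Fin n) (Fin n) ℝ}
    (hS : S.PosSemidef) : (lyap F S - S).PosSemidef := by
  have h : lyap F S - S = F * lyap F S * Fᴴ := by
    rw [Matrix.conjTranspose_eq_transpose_of_trivial, sub_eq_iff_eq_add', ← lyap_eq hF]
  rw [h]
  exact (posSemidef_lyap hF hS).mul_mul_conjTranspose_same F

/-- A positive map is controlled by its value at the identity: bound each term of the series by
`‖M‖` times the corresponding term for `1`. -/
theorem norm_lyap_apply_le (hF : PowSummable F) (M : Matrix (Fin n) (Fin n) ℝ) :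
    ‖lyap F M‖ ≤ ‖lyap F 1‖ * ‖M‖ := by
  refine norm_le_of_abs_dotProduct_mulVec_le (by positivity) fun x y => ?_
  have h := dotProduct_lyap_mulVec hF M x y
  have h1 : ∀ z, HasSum (fun t : ℕ => ((F ^ t)ᵀ *ᵥ z) ⬝ᵥ ((F ^ t)ᵀ *ᵥ z)) (z ⬝ᵥ lyap F 1 *ᵥ z) := by
    intro z
    simpa using dotProduct_lyap_mulVec hF 1 z z
  have h2 := (((h1 x).add (h1 y)).div_const 2).mul_left ‖M‖
  have h3 : |x ⬝ᵥ lyap F M *ᵥ y| ≤ ‖M‖ * ((x ⬝ᵥ lyap F 1 *ᵥ x + y ⬝ᵥ lyap F 1 *ᵥ y) / 2) := by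
    rw [abs_le]
    constructor
    · exact hasSum_le (fun t => (abs_le.mp (abs_dotProduct_mulVec_le M _ _)).1) h2.neg h
    · exact hasSum_le (fun t => (abs_le.mp (abs_dotProduct_mulVec_le M _ _)).2) h h2
  have h4 : ∀ z : Fin n → ℝ, z ⬝ᵥ lyap F 1 *ᵥ z ≤ ‖lyap F 1‖ * (z ⬝ᵥ z) := by
    intro z
    have := abs_dotProduct_mulVec_le (lyap F 1) z z
    rw [add_self_div_two] at this
    exact (le_abs_self _).trans this
  refine h3.trans ?_
  have := mul_le_mul_of_nonneg_left (add_le_add (h4 x) (h4 y)) (norm_nonneg M)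
  linarith

/-- Resolvent identity, obtained by subtracting the two Lyapunov equations. -/
theorem lyap_sub_lyap {F' : Matrix (Fin n) (Fin n) ℝ} (hF : PowSummable F) (hF' : PowSummable F')
    (S : Matrix (Fin n) (Fin n) ℝ) :
    lyap F' S - lyap F S = lyap F (F' * lyap F' S * F'ᵀ - F * lyap F' S * Fᵀ) := by
  refine lyap_unique hF ?_
  have h := lyap_eq hF S
  have h' := lyap_eq hF' S
  set a := lyap F S
  set b := lyap F' S
  rw [Matrix.mul_sub, Matrix.sub_mul]
  conv_lhs => rw [h, h']
  abel

/-- Transposition of matrices as a continuous linear map. -/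
noncomputable def transposeCLM (ι κ : Type*) [Fintype ι] [Fintype κ] [DecidableEq κ]
    [DecidableEq ι] : Matrix ι κ ℝ →L[ℝ] Matrix κ ι ℝ :=
  LinearMap.toContinuousLinearMap (Matrix.transposeLinearEquiv ι κ ℝ ℝ).toLinearMap

theorem hasDerivAt_lyap {f S : ℝ → Matrix (Fin n) (Fin n) ℝ} {f' S' : Matrix (Fin n) (Fin n) ℝ}
    {s : ℝ} (hs : PowSummable (f s)) (hf : HasDerivAt f f' s) (hS : HasDerivAt S S' s) :
    HasDerivAt (fun u => lyap (f u) (S u))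
      (lyap (f s) (S' + (f' * lyap (f s) (S s) * (f s)ᵀ + f s * lyap (f s) (S s) * f'ᵀ))) s :=
  hasDerivAt_stein hs hs.transpose hf
    ((transposeCLM (Fin n) (Fin n)).hasFDerivAt.comp_hasDerivAt s hf) hS

theorem contDiffAt_lyap {E : Type*} [NormedAddCommGroup E] [NormedSpace ℝ E]
    {f S : E → Matrix (Fin n) (Fin n) ℝ} {w : E} {k : WithTop ℕ∞} (hw : PowSummable (f w))
    (hf : ContDiffAt ℝ k f w) (hS : ContDiffAt ℝ k S w) :
    ContDiffAt ℝ k (fun u => lyap (f u) (S u)) w :=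
  contDiffAt_stein hw hw.transpose hf
    ((transposeCLM (Fin n) (Fin n)).contDiff.contDiffAt.comp w hf) hS

end Lyapunov

/-! ### Differentiation of products, transposes and traces. -/

section MatrixCalculus

variable {ι κ l : Type*} [Fintype ι] [Fintype κ] [Fintype l] [DecidableEq ι] [DecidableEq κ]
  [DecidableEq l]

/-- Matrix multiplication as a continuous bilinear map. -/
noncomputable def mulCLM (ι κ l : Type*) [Fintype ι] [Fintype κ] [Fintype l] [DecidableEq ι]
    [DecidableEq κ] [DecidableEq l] : Matrix ι κ ℝ →L[ℝ] Matrix κ l ℝ →L[ℝ] Matrix ι l ℝ :=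
  LinearMap.mkContinuous₂
    (LinearMap.mk₂ ℝ (fun M N => M * N) Matrix.add_mul Matrix.smul_mul Matrix.mul_add
      fun c M N => Matrix.mul_smul M c N) 1
    fun M N => by
      rw [one_mul]
      exact Matrix.l2_opNorm_mul M N

theorem hasDerivAt_mul {f : ℝ → Matrix ι κ ℝ} {g : ℝ → Matrix κ l ℝ} {f' : Matrix ι κ ℝ}
    {g' : Matrix κ l ℝ} {s : ℝ} (hf : HasDerivAt f f' s) (hg : HasDerivAt g g' s) :
    HasDerivAt (fun u => f u * g u) (f s * g' + f' * g s) s :=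
  (mulCLM ι κ l).hasDerivAt_of_bilinear (fun _ => hf) (fun _ => hg)

theorem hasDerivAt_transpose {f : ℝ → Matrix ι κ ℝ} {f' : Matrix ι κ ℝ} {s : ℝ}
    (hf : HasDerivAt f f' s) : HasDerivAt (fun u => (f u)ᵀ) f'ᵀ s :=
  (transposeCLM ι κ).hasFDerivAt.comp_hasDerivAt s hf

theorem contDiff_mul {E : Type*} [NormedAddCommGroup E] [NormedSpace ℝ E] {f : E → Matrix ι κ ℝ}
    {g : E → Matrix κ l ℝ} {k : WithTop ℕ∞} (hf : ContDiff ℝ k f) (hg : ContDiff ℝ k g) :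
    ContDiff ℝ k fun u => f u * g u :=
  (mulCLM ι κ l).isBoundedBilinearMap.contDiff.comp (hf.prodMk hg)

theorem contDiff_transpose {E : Type*} [NormedAddCommGroup E] [NormedSpace ℝ E]
    {f : E → Matrix ι κ ℝ} {k : WithTop ℕ∞} (hf : ContDiff ℝ k f) :
    ContDiff ℝ k fun u => (f u)ᵀ :=
  (transposeCLM ι κ).contDiff.comp hf

/-- The trace of a real matrix as a continuous linear map. -/
noncomputable def traceCLM (ι : Type*) [Fintype ι] [DecidableEq ι] : Matrix ι ι ℝ →L[ℝ] ℝ :=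
  LinearMap.toContinuousLinearMap (Matrix.traceLinearMap ι ℝ ℝ)

theorem hasDerivAt_trace {f : ℝ → Matrix ι ι ℝ} {f' : Matrix ι ι ℝ} {s : ℝ}
    (hf : HasDerivAt f f' s) : HasDerivAt (fun u => (f u).trace) f'.trace s :=
  (traceCLM ι).hasFDerivAt.comp_hasDerivAt s hf

end MatrixCalculus

/-! ### The cost as a trace, and its first two derivatives. -/

section Cost

open Filter Topology MeasureTheory

variable {n m : ℕ} (A : Matrix (Fin n) (Fin n) ℝ) (B : Matrix (Fin n) (Fin m) ℝ)
  (Q : Matrix (Fin n) (Fin n) ℝ) (R : Matrix (Fin m) (Fin m) ℝ)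
  (D : Measure (Fin n → ℝ)) (W : Matrix (Fin m) (Fin n) ℝ)

/-- The value matrix `P` of the feedback `W`: the solution of
`P = Q + Wᵀ R W + (A - B W)ᵀ P (A - B W)`. -/
noncomputable def valueMatrix : Matrix (Fin n) (Fin n) ℝ :=
  lyap (A - B * W)ᵀ (Q + Wᵀ * R * W)

/-- The state correlation matrix `Σ` of the feedback `W`: the solution of
`Σ = 𝔼[x₀ x₀ᵀ] + (A - B W) Σ (A - B W)ᵀ`. -/
noncomputable def stateCorr : Matrix (Fin n) (Fin n) ℝ :=
  lyap (A - B * W) (secondMoment D)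

/-- The matrix `E = R W - Bᵀ P (A - B W)`, for which `2 E Σ` is the gradient of the cost. -/
noncomputable def gradMatrix : Matrix (Fin m) (Fin n) ℝ :=
  R * W - Bᵀ * valueMatrix A B Q R W * (A - B * W)

/-- The derivative of the value matrix in the direction `Z`. -/
noncomputable def valueDeriv (Z : Matrix (Fin m) (Fin n) ℝ) : Matrix (Fin n) (Fin n) ℝ :=
  lyap (A - B * W)ᵀ (Zᵀ * gradMatrix A B Q R W + (gradMatrix A B Q R W)ᵀ * Z)

/-- The derivative of `gradMatrix` in the direction `Y`. -/
noncomputable def gradDeriv (Y : Matrix (Fin m) (Fin n) ℝ) : Matrix (Fin m) (Fin n) ℝ :=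
  (R + Bᵀ * valueMatrix A B Q R W * B) * Y - Bᵀ * valueDeriv A B Q R W Y * (A - B * W)

/-- The source term of the Lyapunov equation satisfied by the second derivative of the value
matrix. -/
noncomputable def hessSource (Y Z : Matrix (Fin m) (Fin n) ℝ) : Matrix (Fin n) (Fin n) ℝ :=
  Zᵀ * gradDeriv A B Q R W Y + (gradDeriv A B Q R W Y)ᵀ * Z
    - ((B * Y)ᵀ * valueDeriv A B Q R W Z * (A - B * W)
      + (A - B * W)ᵀ * valueDeriv A B Q R W Z * (B * Y))

variable {A B Q R D W}

theorem Stabilizing.powSummable (hW : Stabilizing A B W) : PowSummable (A - B * W) :=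
  summable_norm_pow_of_rad_lt_one hW

theorem Stabilizing.eventually (hW : Stabilizing A B W) :
    ∀ᶠ V in 𝓝 W, Stabilizing A B V := by
  have h : Continuous fun V : Matrix (Fin m) (Fin n) ℝ => A - B * V := by fun_prop
  exact eventually_rad_lt_one h.continuousAt hW

theorem hasDerivAt_line {E : Type*} [NormedAddCommGroup E] [NormedSpace ℝ E] (W Y : E) :
    HasDerivAt (fun u : ℝ => W + u • Y) Y 0 := by
  simpa using ((hasDerivAt_id (0 : ℝ)).smul_const Y).const_add W

theorem hasDerivAt_comp_line {E G : Type*} [NormedAddCommGroup E] [NormedSpace ℝ E]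
    [NormedAddCommGroup G] [NormedSpace ℝ G] {f : E → G} {w : E} (hf : DifferentiableAt ℝ f w)
    (z : E) : HasDerivAt (fun u : ℝ => f (w + u • z)) (fderiv ℝ f w z) 0 := by
  have h : HasFDerivAt f (fderiv ℝ f w) (w + (0 : ℝ) • z) := by simpa using hf.hasFDerivAt
  exact h.comp_hasDerivAt (0 : ℝ) (hasDerivAt_line w z)

theorem hasDerivAt_fderiv_comp_line {E : Type*} [NormedAddCommGroup E] [NormedSpace ℝ E]
    {f : E → ℝ} {w : E} (hf : ContDiffAt ℝ 2 f w) (y z : E) :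
    HasDerivAt (fun u : ℝ => fderiv ℝ f (w + u • y) z) (hessian f w y z) 0 := by
  have hd : DifferentiableAt ℝ (fderiv ℝ f) w :=
    (hf.fderiv_right (m := 1) (by norm_num)).differentiableAt (by norm_num)
  simpa [hessian] using (hasDerivAt_comp_line hd y).clm_apply (hasDerivAt_const (0 : ℝ) z)

theorem hasDerivAt_closedLoop (Y : Matrix (Fin m) (Fin n) ℝ) :
    HasDerivAt (fun u : ℝ => A - B * (W + u • Y)) (-(B * Y)) 0 := by
  have h := (hasDerivAt_mul (hasDerivAt_const (0 : ℝ) B) (hasDerivAt_line W Y)).const_sub A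
  refine h.congr_deriv ?_
  simp

theorem valueMatrix_transpose (hQ : Qᵀ = Q) (hR : Rᵀ = R) (hW : Stabilizing A B W) :
    (valueMatrix A B Q R W)ᵀ = valueMatrix A B Q R W := by
  rw [valueMatrix, lyap_transpose hW.powSummable.transpose]
  simp only [Matrix.transpose_add, Matrix.transpose_mul, Matrix.transpose_transpose, hQ, hR,
    Matrix.mul_assoc]

/-- The source is `ZᵀRW + WᵀRZ - (BZ)ᵀPF - FᵀP(BZ)`; symmetry of `P` and `R` groups it as `ZᵀE +
EᵀZ`. -/
theorem hasDerivAt_valueMatrix (hQ : Qᵀ = Q) (hR : Rᵀ = R) (hW : Stabilizing A B W)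
    (Z : Matrix (Fin m) (Fin n) ℝ) :
    HasDerivAt (fun u : ℝ => valueMatrix A B Q R (W + u • Z)) (valueDeriv A B Q R W Z) 0 := by
  have hl := hasDerivAt_line W Z
  have hS : HasDerivAt (fun u : ℝ => Q + (W + u • Z)ᵀ * R * (W + u • Z))
      (Zᵀ * R * W + Wᵀ * R * Z) 0 := by
    refine ((hasDerivAt_mul (hasDerivAt_mul (hasDerivAt_transpose hl)
      (hasDerivAt_const (0 : ℝ) R)) hl).const_add Q).congr_deriv ?_
    simp
    abel
  have h := hasDerivAt_lyap (f := fun u : ℝ => (A - B * (W + u • Z))ᵀ)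
    (by simpa using hW.powSummable.transpose) (hasDerivAt_transpose (hasDerivAt_closedLoop Z)) hS
  refine h.congr_deriv ?_
  have hP := valueMatrix_transpose hQ hR hW
  simp only [zero_smul, add_zero]
  rw [← valueMatrix, valueDeriv]
  congr 1
  simp only [gradMatrix, Matrix.transpose_sub, Matrix.transpose_mul, Matrix.transpose_transpose,
    hP, hR, Matrix.transpose_neg, Matrix.mul_sub, Matrix.sub_mul, Matrix.neg_mul, Matrix.mul_neg,
    Matrix.mul_assoc]
  abel

theorem hasDerivAt_gradMatrix (hQ : Qᵀ = Q) (hR : Rᵀ = R) (hW : Stabilizing A B W)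
    (Y : Matrix (Fin m) (Fin n) ℝ) :
    HasDerivAt (fun u : ℝ => gradMatrix A B Q R (W + u • Y)) (gradDeriv A B Q R W Y) 0 := by
  have hP := hasDerivAt_valueMatrix hQ hR hW Y
  have h := (hasDerivAt_mul (hasDerivAt_const (0 : ℝ) R) (hasDerivAt_line W Y)).sub
    (hasDerivAt_mul (hasDerivAt_mul (hasDerivAt_const (0 : ℝ) Bᵀ) hP)
      (hasDerivAt_closedLoop (A := A) (B := B) (W := W) Y))
  refine h.congr_deriv ?_
  simp only [zero_smul, add_zero, gradDeriv, Matrix.zero_mul, Matrix.mul_neg, Matrix.add_mul,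
    Matrix.mul_assoc]
  abel

theorem hasDerivAt_valueDeriv (hQ : Qᵀ = Q) (hR : Rᵀ = R) (hW : Stabilizing A B W)
    (Y Z : Matrix (Fin m) (Fin n) ℝ) :
    HasDerivAt (fun u : ℝ => valueDeriv A B Q R (W + u • Y) Z)
      (lyap (A - B * W)ᵀ (hessSource A B Q R W Y Z)) 0 := by
  have hE := hasDerivAt_gradMatrix hQ hR hW Y
  have hS : HasDerivAt (fun u : ℝ => Zᵀ * gradMatrix A B Q R (W + u • Y) +
      (gradMatrix A B Q R (W + u • Y))ᵀ * Z)
      (Zᵀ * gradDeriv A B Q R W Y + (gradDeriv A B Q R W Y)ᵀ * Z) 0 := by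
    refine ((hasDerivAt_mul (hasDerivAt_const (0 : ℝ) Zᵀ) hE).add
      (hasDerivAt_mul (hasDerivAt_transpose hE) (hasDerivAt_const (0 : ℝ) Z))).congr_deriv ?_
    simp
  have h := hasDerivAt_lyap (f := fun u : ℝ => (A - B * (W + u • Y))ᵀ)
    (by simpa using hW.powSummable.transpose) (hasDerivAt_transpose (hasDerivAt_closedLoop Y)) hS
  refine h.congr_deriv ?_
  simp only [zero_smul, add_zero]
  rw [← valueDeriv]
  congr 1
  simp only [hessSource, Matrix.transpose_transpose, Matrix.transpose_neg, Matrix.neg_mul,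
    Matrix.mul_neg]
  abel

theorem state_eq_pow_mulVec (x₀ : Fin n → ℝ) (t : ℕ) :
    state A B W x₀ t = (A - B * W) ^ t *ᵥ x₀ := by
  induction t with
  | zero => simp [state]
  | succ t ih =>
    rw [state, ih, Matrix.mulVec_neg, pow_succ', ← Matrix.mulVec_mulVec, Matrix.sub_mulVec,
      ← Matrix.mulVec_mulVec]
    exact (sub_eq_add_neg _ _).symm

theorem integral_sum_sum_mul {μ : Measure (Fin n → ℝ)} (p : Fin n → Fin n → ℝ)
    (h : ∀ i j, Integrable (fun x : Fin n → ℝ => x i * x j) μ) :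
    ∫ x, ∑ i, ∑ j, p i j * (x i * x j) ∂μ = ∑ i, ∑ j, p i j * ∫ x, x i * x j ∂μ := by
  rw [integral_finsetSum _ fun i _ => integrable_finsetSum _ fun j _ => (h i j).const_mul _]
  refine Finset.sum_congr rfl fun i _ => ?_
  rw [integral_finsetSum _ fun j _ => (h i j).const_mul _]
  exact Finset.sum_congr rfl fun j _ => integral_const_mul _ _

/-- For each `x₀` the series sums to `x₀ᵀ P x₀`, so only a finite sum is exchanged with the
expectation. -/
theorem cost_eq_trace (hD : ∀ i, MemLp (fun x₀ : Fin n → ℝ => x₀ i) 2 D)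
    (hW : Stabilizing A B W) :
    cost A B Q R D W = (secondMoment D * valueMatrix A B Q R W).trace := by
  have h1 : ∀ x₀ : Fin n → ℝ,
      ∑' t : ℕ, state A B W x₀ t ⬝ᵥ ((Q + Wᵀ * R * W) *ᵥ state A B W x₀ t) =
        ∑ i, ∑ j, valueMatrix A B Q R W i j * (x₀ i * x₀ j) := by
    intro x₀
    have h := (dotProduct_lyap_mulVec hW.powSummable.transpose (Q + Wᵀ * R * W) x₀ x₀).tsum_eq
    simp only [← Matrix.transpose_pow, Matrix.transpose_transpose] at h
    simp only [state_eq_pow_mulVec]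
    rw [h, ← valueMatrix]
    simp only [dotProduct, Matrix.mulVec, Finset.mul_sum]
    exact Finset.sum_congr rfl fun i _ => Finset.sum_congr rfl fun j _ => by ring
  have hint : ∀ i j, Integrable (fun x₀ : Fin n → ℝ => x₀ i * x₀ j) D :=
    fun i j => (hD i).integrable_mul (hD j)
  simp only [cost, h1]
  rw [integral_sum_sum_mul (fun i j => valueMatrix A B Q R W i j) hint]
  simp only [Matrix.trace, Matrix.diag_apply, Matrix.mul_apply, secondMoment, Matrix.of_apply]
  rw [Finset.sum_comm]
  refine Finset.sum_congr rfl fun i _ => Finset.sum_congr rfl fun j _ => ?_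
  simp only [mul_comm]

theorem contDiffAt_cost (hD : ∀ i, MemLp (fun x₀ : Fin n → ℝ => x₀ i) 2 D)
    (hW : Stabilizing A B W) : ContDiffAt ℝ 2 (cost A B Q R D) W := by
  have hcl : ContDiff ℝ 2 fun V : Matrix (Fin m) (Fin n) ℝ => (A - B * V)ᵀ :=
    contDiff_transpose (contDiff_const.sub (contDiff_mul contDiff_const contDiff_id))
  have hS : ContDiff ℝ 2 fun V : Matrix (Fin m) (Fin n) ℝ => Q + Vᵀ * R * V :=
    contDiff_const.add (contDiff_mul (contDiff_mul (contDiff_transpose contDiff_id) contDiff_const)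
      contDiff_id)
  have hP : ContDiffAt ℝ 2 (fun V => valueMatrix A B Q R V) W :=
    contDiffAt_lyap (f := fun V => (A - B * V)ᵀ) hW.powSummable.transpose hcl.contDiffAt
      hS.contDiffAt
  let φ := (traceCLM (Fin n)).comp (mulCLM (Fin n) (Fin n) (Fin n) (secondMoment D))
  have h : ContDiffAt ℝ 2 (fun V => φ (valueMatrix A B Q R V)) W :=
    φ.contDiff.contDiffAt.comp W hP
  refine h.congr_of_eventuallyEq ?_
  -- The trace formula holds only at stabilizing matrices; openness makes this a neighbourhood of
  -- `W`.
  filter_upwards [hW.eventually] with V hV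
  exact cost_eq_trace hD hV

theorem fderiv_cost_apply (hQ : Qᵀ = Q) (hR : Rᵀ = R)
    (hD : ∀ i, MemLp (fun x₀ : Fin n → ℝ => x₀ i) 2 D) (hW : Stabilizing A B W)
    (Z : Matrix (Fin m) (Fin n) ℝ) :
    fderiv ℝ (cost A B Q R D) W Z = (secondMoment D * valueDeriv A B Q R W Z).trace := by
  have hl := hasDerivAt_line W Z
  have h1 : HasDerivAt (fun u : ℝ => cost A B Q R D (W + u • Z))
      (fderiv ℝ (cost A B Q R D) W Z) 0 :=
    hasDerivAt_comp_line ((contDiffAt_cost hD hW).differentiableAt (by norm_num)) Z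
  have h2 := hasDerivAt_trace (hasDerivAt_mul (hasDerivAt_const (0 : ℝ) (secondMoment D))
    (hasDerivAt_valueMatrix hQ hR hW Z))
  have hev : ∀ᶠ u : ℝ in 𝓝 0, Stabilizing A B (W + u • Z) := by
    have := hl.continuousAt
    refine this.eventually ?_
    simpa using hW.eventually
  have h3 := h2.congr_of_eventuallyEq (f₁ := fun u : ℝ => cost A B Q R D (W + u • Z))
    (hev.mono fun u hu => cost_eq_trace hD hu)
  have := h1.unique h3
  simpa using this

theorem hessian_cost_apply (hQ : Qᵀ = Q) (hR : Rᵀ = R)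
    (hD : ∀ i, MemLp (fun x₀ : Fin n → ℝ => x₀ i) 2 D) (hW : Stabilizing A B W)
    (Y Z : Matrix (Fin m) (Fin n) ℝ) :
    hessian (cost A B Q R D) W Y Z =
      (stateCorr A B D W * hessSource A B Q R W Y Z).trace := by
  have hl := hasDerivAt_line W Y
  have h1 := hasDerivAt_fderiv_comp_line (contDiffAt_cost (Q := Q) (R := R) hD hW) Y Z
  have h2 := hasDerivAt_trace (hasDerivAt_mul (hasDerivAt_const (0 : ℝ) (secondMoment D))
    (hasDerivAt_valueDeriv hQ hR hW Y Z))
  have hev : ∀ᶠ u : ℝ in 𝓝 0, Stabilizing A B (W + u • Y) := by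
    have := hl.continuousAt
    refine this.eventually ?_
    simpa using hW.eventually
  have h3 := h2.congr_of_eventuallyEq
    (f₁ := fun u : ℝ => fderiv ℝ (cost A B Q R D) (W + u • Y) Z)
    (hev.mono fun u hu => fderiv_cost_apply hQ hR hD hu Z)
  rw [h1.unique h3, stateCorr, trace_lyap_mul hW.powSummable]
  simp

end Cost

/-! ### Perturbation of Lyapunov solutions. -/

section Perturbation

variable {n : ℕ} {F F' : Matrix (Fin n) (Fin n) ℝ} {κ α ε : ℝ}

theorem norm_conj_sub_conj_le (hF : ‖F‖ ≤ α) (hF' : ‖F'‖ ≤ α) (hd : ‖F' - F‖ ≤ ε)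
    (X : Matrix (Fin n) (Fin n) ℝ) :
    ‖F' * X * F'ᵀ - F * X * Fᵀ‖ ≤ 2 * α * ε * ‖X‖ := by
  have h : F' * X * F'ᵀ - F * X * Fᵀ = (F' - F) * X * F'ᵀ + F * X * (F' - F)ᵀ := by
    simp only [Matrix.sub_mul, Matrix.mul_sub, Matrix.transpose_sub]
    abel
  rw [h]
  calc _ ≤ _ := norm_add_le _ _
    _ ≤ ε * ‖X‖ * α + α * ‖X‖ * ε :=
      add_le_add (norm_mul_le_of_le (norm_mul_le_of_le hd le_rfl)
          ((norm_transpose F').le.trans hF'))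
        (norm_mul_le_of_le (norm_mul_le_of_le hF le_rfl) ((norm_transpose _).le.trans hd))
    _ = _ := by ring

/-- The resolvent identity bounds the difference by `2καε ‖lyap F' M‖`, at most half of `‖lyap F'
M‖`, which is absorbed on the left. -/
theorem norm_lyap_perturbed_le (hF : PowSummable F) (hF' : PowSummable F')
    (hκ : ∀ M, ‖lyap F M‖ ≤ κ * ‖M‖) (hκ0 : 0 ≤ κ) (ha : ‖F‖ ≤ α) (ha' : ‖F'‖ ≤ α)
    (hd : ‖F' - F‖ ≤ ε) (hsmall : 4 * κ * (α * ε) ≤ 1) (M : Matrix (Fin n) (Fin n) ℝ) :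
    ‖lyap F' M‖ ≤ 2 * κ * ‖M‖ ∧ ‖lyap F' M - lyap F M‖ ≤ 4 * κ ^ 2 * (α * ε) * ‖M‖ := by
  have hα : 0 ≤ α * ε := mul_nonneg ((norm_nonneg _).trans ha) ((norm_nonneg _).trans hd)
  have h1 : ‖lyap F' M - lyap F M‖ ≤ 2 * κ * (α * ε) * ‖lyap F' M‖ := by
    rw [lyap_sub_lyap hF hF']
    refine (hκ _).trans ?_
    have := mul_le_mul_of_nonneg_left (norm_conj_sub_conj_le ha ha' hd (lyap F' M)) hκ0
    linarith
  have h2 : ‖lyap F' M‖ ≤ ‖lyap F M‖ + ‖lyap F' M - lyap F M‖ := by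
    have := norm_add_le (lyap F M) (lyap F' M - lyap F M)
    rwa [add_sub_cancel] at this
  have h3 : 2 * κ * (α * ε) * ‖lyap F' M‖ ≤ 1 / 2 * ‖lyap F' M‖ :=
    mul_le_mul_of_nonneg_right (by linarith) (norm_nonneg _)
  have h4 : ‖lyap F' M‖ ≤ 2 * κ * ‖M‖ := by linarith [hκ M]
  refine ⟨h4, h1.trans ?_⟩
  calc _ ≤ 2 * κ * (α * ε) * (2 * κ * ‖M‖) := by gcongr
    _ = _ := by ring

/-- Dual form of the preceding bound. The solution operator and the conjugations move onto the test
matrix `M`, leaving the positive `lyap F' S`, which enters through its trace. The choice `M = 1`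
gives the trace bound by absorption. -/
theorem abs_trace_lyap_perturbed_le (hF : PowSummable F) (hF' : PowSummable F')
    (hκ : ∀ M, ‖lyap Fᵀ M‖ ≤ κ * ‖M‖) (hκ0 : 0 ≤ κ) (ha : ‖F‖ ≤ α) (ha' : ‖F'‖ ≤ α)
    (hd : ‖F' - F‖ ≤ ε) (hsmall : 4 * κ * (α * ε) ≤ 1) {S : Matrix (Fin n) (Fin n) ℝ}
    (hS : S.PosSemidef) {q : ℝ} (hq : (lyap F S).trace ≤ q) :
    (lyap F' S).trace ≤ 2 * q ∧
      ∀ M, |((lyap F' S - lyap F S) * M).trace| ≤ 4 * κ * (α * ε) * q * ‖M‖ := by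
  have hα : 0 ≤ α * ε := mul_nonneg ((norm_nonneg _).trans ha) ((norm_nonneg _).trans hd)
  have hpos := posSemidef_lyap hF' hS
  have h1 : ∀ M, |((lyap F' S - lyap F S) * M).trace| ≤
      2 * κ * (α * ε) * ‖M‖ * (lyap F' S).trace := by
    intro M
    rw [lyap_sub_lyap hF hF', trace_lyap_mul hF]
    set N := lyap Fᵀ M
    have h : ((F' * lyap F' S * F'ᵀ - F * lyap F' S * Fᵀ) * N).trace =
        ((F'ᵀ * N * F'ᵀᵀ - Fᵀ * N * Fᵀᵀ) * lyap F' S).trace := by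
      simp only [Matrix.transpose_transpose]
      rw [Matrix.sub_mul, Matrix.sub_mul, Matrix.trace_sub, Matrix.trace_sub]
      congr 1 <;>
      · rw [Matrix.trace_mul_comm _ N, Matrix.trace_mul_comm _ (lyap F' S),
          Matrix.mul_assoc _ (lyap F' S), ← Matrix.mul_assoc N, Matrix.trace_mul_comm]
        simp only [Matrix.mul_assoc]
    rw [h]
    refine (abs_trace_mul_le _ hpos).trans
      (mul_le_mul_of_nonneg_right ?_ hpos.trace_nonneg)
    refine (norm_conj_sub_conj_le (ε := ε) (F := Fᵀ) (F' := F'ᵀ) ((norm_transpose F).le.trans ha)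
      ((norm_transpose F').le.trans ha') ?_ N).trans ?_
    · rw [← Matrix.transpose_sub, norm_transpose]
      exact hd
    · calc 2 * α * ε * ‖N‖ = 2 * (α * ε) * ‖N‖ := by ring
        _ ≤ 2 * (α * ε) * (κ * ‖M‖) := by gcongr; exact hκ M
        _ = _ := by ring
  have h2 : (lyap F' S).trace ≤ 2 * q := by
    have h := h1 1
    -- Only an inequality, since `n = 0` is allowed here.
    have hone : ‖(1 : Matrix (Fin n) (Fin n) ℝ)‖ ≤ 1 := by
      refine norm_le_of_abs_dotProduct_mulVec_le zero_le_one fun x y => ?_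
      rw [Matrix.one_mulVec, abs_le]
      have h1 := dotProduct_self_star_nonneg (x + y)
      have h2 := dotProduct_self_star_nonneg (x - y)
      simp only [star_trivial, add_dotProduct, dotProduct_add, sub_dotProduct, dotProduct_sub,
        dotProduct_comm y x] at h1 h2
      constructor <;> linarith
    rw [Matrix.mul_one, Matrix.trace_sub] at h
    have h3 : 2 * κ * (α * ε) * ‖(1 : Matrix (Fin n) (Fin n) ℝ)‖ ≤ 1 / 2 :=
      (mul_le_of_le_one_right (by positivity) hone).trans (by linarith)
    have h4 := mul_le_mul_of_nonneg_right h3 hpos.trace_nonneg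
    linarith [(abs_le.mp h).2]
  refine ⟨h2, fun M => (h1 M).trans ?_⟩
  calc _ ≤ 2 * κ * (α * ε) * ‖M‖ * (2 * q) := by gcongr
    _ = _ := by ring

end Perturbation

/-! ### Exact difference formulas between `W` and `U`. -/

section HessianPerturbation

variable {n m : ℕ} {A : Matrix (Fin n) (Fin n) ℝ} {B : Matrix (Fin n) (Fin m) ℝ}
  {Q : Matrix (Fin n) (Fin n) ℝ} {R : Matrix (Fin m) (Fin m) ℝ}
  {D : MeasureTheory.Measure (Fin n → ℝ)} {W U : Matrix (Fin m) (Fin n) ℝ}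

theorem norm_triple_mul_le {k l : ℕ} {X : Matrix (Fin k) (Fin n) ℝ} {Y : Matrix (Fin n) (Fin m) ℝ}
    {Z : Matrix (Fin m) (Fin l) ℝ} {x y z : ℝ} (hx : ‖X‖ ≤ x) (hy : ‖Y‖ ≤ y) (hz : ‖Z‖ ≤ z) :
    ‖X * Y * Z‖ ≤ x * y * z :=
  norm_mul_le_of_le (norm_mul_le_of_le hx hy) hz

theorem norm_transpose_mul_add_le {E Z : Matrix (Fin m) (Fin n) ℝ} {e z : ℝ} (hE : ‖E‖ ≤ e)
    (hZ : ‖Z‖ ≤ z) : ‖Zᵀ * E + Eᵀ * Z‖ ≤ 2 * (z * e) := by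
  calc _ ≤ _ := norm_add_le _ _
    _ ≤ z * e + e * z := add_le_add (norm_mul_le_of_le ((norm_transpose Z).le.trans hZ) hE)
      (norm_mul_le_of_le ((norm_transpose E).le.trans hE) hZ)
    _ = _ := by ring

/-- Cost-difference identity: expanding the equation at `U` around `P_W` with `A - BU = F - B(U-W)`
leaves an exact source, quadratic in `U - W`, with coefficients taken at `W`. -/
theorem valueMatrix_sub (hQ : Qᵀ = Q) (hR : Rᵀ = R) (hW : Stabilizing A B W)
    (hU : Stabilizing A B U) :
    valueMatrix A B Q R U - valueMatrix A B Q R W =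
      lyap (A - B * U)ᵀ ((U - W)ᵀ * gradMatrix A B Q R W + (gradMatrix A B Q R W)ᵀ * (U - W)
        + (U - W)ᵀ * (R + Bᵀ * valueMatrix A B Q R W * B) * (U - W)) := by
  refine lyap_unique hU.powSummable.transpose ?_
  have hs := valueMatrix_transpose hQ hR hW
  have h1 := lyap_eq hU.powSummable.transpose (Q + Uᵀ * R * U)
  have h2 := lyap_eq hW.powSummable.transpose (Q + Wᵀ * R * W)
  rw [← valueMatrix, Matrix.transpose_transpose] at h1 h2
  rw [gradMatrix, Matrix.transpose_sub (R * W), Matrix.transpose_mul R,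
    Matrix.transpose_mul _ (A - B * W), Matrix.transpose_mul Bᵀ,
    Matrix.transpose_transpose, Matrix.transpose_transpose, hs, hR]
  set P := valueMatrix A B Q R W
  set P' := valueMatrix A B Q R U
  rw [Matrix.mul_sub (A - B * U)ᵀ, Matrix.sub_mul _ _ (A - B * U)]
  have h3 : P' - (A - B * U)ᵀ * P' * (A - B * U) = Q + Uᵀ * R * U := by
    rw [sub_eq_iff_eq_add]; exact h1
  have h4 : P - (A - B * W)ᵀ * P * (A - B * W) = Q + Wᵀ * R * W := by
    rw [sub_eq_iff_eq_add]; exact h2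
  rw [← sub_eq_iff_eq_add]
  have h5 : P' - P - ((A - B * U)ᵀ * P' * (A - B * U) - (A - B * U)ᵀ * P * (A - B * U)) =
      (Q + Uᵀ * R * U) - (Q + Wᵀ * R * W) - (A - B * W)ᵀ * P * (A - B * W)
        + (A - B * U)ᵀ * P * (A - B * U) := by
    rw [← h3, ← h4]
    abel
  rw [h5]
  simp only [Matrix.transpose_sub, Matrix.transpose_mul, Matrix.mul_sub, Matrix.sub_mul,
    Matrix.mul_add, Matrix.add_mul, Matrix.mul_assoc]
  abel

theorem gradMatrix_sub :
    gradMatrix A B Q R U - gradMatrix A B Q R W =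
      (R + Bᵀ * valueMatrix A B Q R W * B) * (U - W)
        - Bᵀ * (valueMatrix A B Q R U - valueMatrix A B Q R W) * (A - B * U) := by
  simp only [gradMatrix, Matrix.mul_sub, Matrix.sub_mul, Matrix.add_mul, Matrix.mul_assoc]
  abel

theorem gradDeriv_sub (Y : Matrix (Fin m) (Fin n) ℝ) :
    gradDeriv A B Q R U Y - gradDeriv A B Q R W Y =
      Bᵀ * (valueMatrix A B Q R U - valueMatrix A B Q R W) * (B * Y)
        - Bᵀ * (valueDeriv A B Q R U Y - valueDeriv A B Q R W Y) * (A - B * U)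
        + Bᵀ * valueDeriv A B Q R W Y * (B * (U - W)) := by
  simp only [gradDeriv, Matrix.mul_sub, Matrix.sub_mul, Matrix.add_mul, Matrix.mul_assoc]
  abel

/-- The telescoping puts `A - BU` beside the differences and keeps the other factors at `W`, where
bounds in terms of the cost are available. -/
theorem hessSource_sub (Y Z : Matrix (Fin m) (Fin n) ℝ) :
    hessSource A B Q R U Y Z - hessSource A B Q R W Y Z =
      (Zᵀ * (gradDeriv A B Q R U Y - gradDeriv A B Q R W Y) +
        (gradDeriv A B Q R U Y - gradDeriv A B Q R W Y)ᵀ * Z)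
      - ((B * Y)ᵀ * (valueDeriv A B Q R U Z - valueDeriv A B Q R W Z) * (A - B * U)
        + (A - B * U)ᵀ * (valueDeriv A B Q R U Z - valueDeriv A B Q R W Z) * (B * Y))
      + ((B * Y)ᵀ * valueDeriv A B Q R W Z * (B * (U - W))
        + (B * (U - W))ᵀ * valueDeriv A B Q R W Z * (B * Y)) := by
  simp only [hessSource, Matrix.transpose_sub, Matrix.transpose_mul, Matrix.mul_sub,
    Matrix.sub_mul, Matrix.mul_assoc]
  abel

theorem valueDeriv_sub (Z : Matrix (Fin m) (Fin n) ℝ) :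
    valueDeriv A B Q R U Z - valueDeriv A B Q R W Z =
      lyap (A - B * U)ᵀ (Zᵀ * (gradMatrix A B Q R U - gradMatrix A B Q R W) +
        (gradMatrix A B Q R U - gradMatrix A B Q R W)ᵀ * Z)
      + (lyap (A - B * U)ᵀ (Zᵀ * gradMatrix A B Q R W + (gradMatrix A B Q R W)ᵀ * Z)
        - lyap (A - B * W)ᵀ (Zᵀ * gradMatrix A B Q R W + (gradMatrix A B Q R W)ᵀ * Z)) := by
  rw [valueDeriv, valueDeriv, ← add_sub_assoc, ← map_add]
  congr 2
  simp only [Matrix.transpose_sub, Matrix.mul_sub, Matrix.sub_mul]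
  abel

end HessianPerturbation

/-! ### The quantitative Hessian estimate. -/

section HessianBound

variable {n m : ℕ} {A : Matrix (Fin n) (Fin n) ℝ} {B : Matrix (Fin n) (Fin m) ℝ}
  {Q : Matrix (Fin n) (Fin n) ℝ} {R : Matrix (Fin m) (Fin m) ℝ}
  {D : MeasureTheory.Measure (Fin n → ℝ)} {W U : Matrix (Fin m) (Fin n) ℝ}

theorem norm_add_transpose_mul_mul_le {P : Matrix (Fin n) (Fin n) ℝ} {b r p : ℝ} (hB : ‖B‖ ≤ b)
    (hR : ‖R‖ ≤ r) (hP : ‖P‖ ≤ p) : ‖R + Bᵀ * P * B‖ ≤ r + b ^ 2 * p := by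
  calc _ ≤ _ := norm_add_le _ _
    _ ≤ r + b * p * b := add_le_add hR (norm_triple_mul_le ((norm_transpose B).le.trans hB) hP hB)
    _ = _ := by ring

/-- After removing `κd`, the bounds `bd ≤ 1/4`, `b ≤ γ` and `κ ≥ 1` give at most `58 γg + 224 κγ²e`,
below the claimed `64 γg + 256 κγ²e`. -/
theorem hessian_perturbation_arith {κ b a d g e : ℝ} (hκ : 1 ≤ κ) (hb : 0 ≤ b) (ha : 0 ≤ a)
    (hd : 0 ≤ d) (hg : 0 ≤ g) (he : 0 ≤ e) (hbd : 4 * (b * d) ≤ 1) :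
    2 * (2 * (b ^ 2 * (2 * κ * d * (2 * e + g * d))
        + b * (a + 1) * (κ * d * (6 * g + 24 * κ * (b * (a + 1)) * e)) + 2 * κ * e * b ^ 2 * d)
      + 2 * (b * (a + 1) * (κ * d * (6 * g + 24 * κ * (b * (a + 1)) * e)))
      + 4 * κ * e * b ^ 2 * d)
      + 4 * κ * (b * (a + 1)) * d * (2 * (g + 2 * a * b * κ * e) + 4 * a * b * κ * e) ≤
    64 * κ * (b * (a + 1)) * d * (g + 4 * κ * (b * (a + 1)) * e) := by
  set γ := b * (a + 1) with hγ
  have hγ0 : 0 ≤ γ := by positivity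
  have hbγ : b ≤ γ := by rw [hγ]; nlinarith [mul_nonneg hb ha]
  have h1 : 4 * (b ^ 2 * d * g) ≤ γ * g := by
    calc 4 * (b ^ 2 * d * g) = (4 * (b * d)) * (b * g) := by ring
      _ ≤ 1 * (b * g) := by gcongr
      _ ≤ γ * g := by rw [one_mul]; gcongr
  have h2 : b ^ 2 * e ≤ κ * γ * b * e := by
    calc b ^ 2 * e = 1 * b * b * e := by ring
      _ ≤ κ * γ * b * e := by gcongr
  have h3 : κ * γ * b * e + κ * γ * (a * b) * e = κ * γ ^ 2 * e := by rw [hγ]; ring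
  have h4 : 0 ≤ κ * γ ^ 2 * e := by positivity
  have h5 : 0 ≤ γ * g := by positivity
  have h6 : 32 * (b ^ 2 * e) + 8 * (b ^ 2 * d * g) + 48 * (γ * g) + 192 * (κ * γ ^ 2 * e)
      + 8 * (γ * g) + 32 * (κ * γ * (a * b) * e) ≤ 64 * (γ * g) + 256 * (κ * γ ^ 2 * e) := by
    linarith
  have h7 := mul_le_mul_of_nonneg_left h6 (mul_nonneg (zero_le_one.trans hκ) hd)
  calc _ = κ * d * (32 * (b ^ 2 * e) + 8 * (b ^ 2 * d * g) + 48 * (γ * g)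
        + 192 * (κ * γ ^ 2 * e) + 8 * (γ * g) + 32 * (κ * γ * (a * b) * e)) := by ring
    _ ≤ _ := h7
    _ = _ := by ring

theorem abs_trace_hessSource_sub_le (hQ : Qᵀ = Q) (hR : Rᵀ = R) (hM : (secondMoment D).PosSemidef)
    (hW : Stabilizing A B W) (hU : Stabilizing A B U) {κ b a r d p e q : ℝ} (hκ1 : 1 ≤ κ)
    (hκ : ∀ M, ‖lyap (A - B * W)ᵀ M‖ ≤ κ * ‖M‖) (hb : ‖B‖ ≤ b) (ha : ‖A - B * W‖ ≤ a)
    (hr : ‖R‖ ≤ r) (hd : ‖U - W‖ ≤ d) (hp : ‖valueMatrix A B Q R W‖ ≤ p)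
    (he : ‖gradMatrix A B Q R W‖ ≤ e) (hq : (stateCorr A B D W).trace ≤ q)
    (hsmall : 4 * κ * (b * (a + 1)) * d ≤ 1) {Y Z : Matrix (Fin m) (Fin n) ℝ} (hY : ‖Y‖ ≤ 1)
    (hZ : ‖Z‖ ≤ 1) :
    |(stateCorr A B D U * hessSource A B Q R U Y Z).trace
      - (stateCorr A B D W * hessSource A B Q R W Y Z).trace| ≤
    64 * κ * q * (b * (a + 1)) * (r + b ^ 2 * p + 4 * κ * (b * (a + 1)) * e) * d := by
  have hb0 := (norm_nonneg _).trans hb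
  have ha0 := (norm_nonneg _).trans ha
  have hd0 := (norm_nonneg _).trans hd
  have hp0 := (norm_nonneg _).trans hp
  have he0 := (norm_nonneg _).trans he
  have hr0 := (norm_nonneg _).trans hr
  have hκ0 : 0 ≤ κ := zero_le_one.trans hκ1
  have hq0 : 0 ≤ q := (posSemidef_lyap hW.powSummable hM).trace_nonneg.trans hq
  -- Since `κ ≥ 1` and `a + 1 ≥ 1`, smallness forces `bd ≤ 1/4`, which keeps `‖A - BU‖` below `a +
  -- 1`.
  have hbd : 4 * (b * d) ≤ 1 := by
    calc 4 * (b * d) = 4 * 1 * (b * 1) * d := by ring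
      _ ≤ 4 * κ * (b * (a + 1)) * d := by gcongr; linarith
      _ ≤ 1 := hsmall
  have hBD : ‖B * (U - W)‖ ≤ b * d := norm_mul_le_of_le hb hd
  have hBY : ‖B * Y‖ ≤ b := by simpa using norm_mul_le_of_le hb hY
  have hBt : ‖Bᵀ‖ ≤ b := (norm_transpose B).le.trans hb
  have hBYt : ‖(B * Y)ᵀ‖ ≤ b := (norm_transpose _).le.trans hBY
  have hBDt : ‖(B * (U - W))ᵀ‖ ≤ b * d := (norm_transpose _).le.trans hBD
  have hFF : ‖(A - B * U) - (A - B * W)‖ ≤ b * d := by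
    have : (A - B * U) - (A - B * W) = -(B * (U - W)) := by rw [Matrix.mul_sub]; abel
    rw [this, norm_neg]
    exact hBD
  have ha1 : ‖A - B * W‖ ≤ a + 1 := by linarith
  have hU1 : ‖A - B * U‖ ≤ a + 1 := by
    have := norm_add_le (A - B * W) ((A - B * U) - (A - B * W))
    rw [add_sub_cancel] at this
    linarith
  have hsmall' : 4 * κ * ((a + 1) * (b * d)) ≤ 1 := by linarith
  set F := A - B * W with hFdef
  set F' := A - B * U with hFdef'
  have hFt : ‖Fᵀ‖ ≤ a + 1 := (norm_transpose F).le.trans ha1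
  have hFat : ‖Fᵀ‖ ≤ a := (norm_transpose F).le.trans ha
  have hFt' : ‖F'ᵀ‖ ≤ a + 1 := (norm_transpose F').le.trans hU1
  have hFFt : ‖F'ᵀ - Fᵀ‖ ≤ b * d := by
    rw [← Matrix.transpose_sub, norm_transpose]
    exact hFF
  have hT := norm_lyap_perturbed_le hW.powSummable.transpose hU.powSummable.transpose hκ hκ0
    hFt hFt' hFFt hsmall'
  obtain ⟨htr, hcorr⟩ := abs_trace_lyap_perturbed_le hW.powSummable hU.powSummable hκ hκ0 ha1 hU1
    hFF hsmall' hM hq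
  set g := r + b ^ 2 * p with hg
  have hg0 : 0 ≤ g := by positivity
  have hG := norm_add_transpose_mul_mul_le (R := R) hb hr hp
  rw [← hg] at hG
  set γ := b * (a + 1) with hγ
  have hγ0 : 0 ≤ γ := by positivity
  have hP : ‖valueMatrix A B Q R U - valueMatrix A B Q R W‖ ≤ 2 * κ * d * (2 * e + g * d) := by
    rw [valueMatrix_sub hQ hR hW hU]
    refine (hT _).1.trans ?_
    have h : ‖(U - W)ᵀ * gradMatrix A B Q R W + (gradMatrix A B Q R W)ᵀ * (U - W)
        + (U - W)ᵀ * (R + Bᵀ * valueMatrix A B Q R W * B) * (U - W)‖ ≤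
        2 * (d * e) + d * g * d :=
      (norm_add_le _ _).trans (add_le_add (norm_transpose_mul_add_le he hd)
        (norm_mul_le_of_le (norm_mul_le_of_le ((norm_transpose _).le.trans hd) hG) hd))
    calc _ ≤ 2 * κ * (2 * (d * e) + d * g * d) := by gcongr
      _ = _ := by ring
  -- In `3/2`, the unit is the direct term and the half is the quadratic term after `4κγd ≤ 1`.
  have hE : ‖gradMatrix A B Q R U - gradMatrix A B Q R W‖ ≤ d * (3 / 2 * g + 4 * κ * γ * e) := by
    rw [gradMatrix_sub]
    have h : b * (2 * κ * d * (2 * e + g * d)) * (a + 1) ≤ d * (1 / 2 * g + 4 * κ * γ * e) := by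
      have h1 : 2 * κ * γ * d * (g * d) ≤ 1 / 2 * (g * d) :=
        mul_le_mul_of_nonneg_right (by linarith) (by positivity)
      calc _ = 4 * κ * γ * e * d + 2 * κ * γ * d * (g * d) := by rw [hγ]; ring
        _ ≤ 4 * κ * γ * e * d + 1 / 2 * (g * d) := by linarith
        _ = _ := by ring
    calc _ ≤ _ := norm_sub_le _ _
      _ ≤ g * d + b * (2 * κ * d * (2 * e + g * d)) * (a + 1) :=
        add_le_add (norm_mul_le_of_le hG hd) (norm_mul_le_of_le (norm_mul_le_of_le hBt hP) hU1)
      _ ≤ g * d + d * (1 / 2 * g + 4 * κ * γ * e) := by gcongr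
      _ = _ := by ring
  have hVW : ∀ {X : Matrix (Fin m) (Fin n) ℝ}, ‖X‖ ≤ 1 →
      ‖valueDeriv A B Q R W X‖ ≤ 2 * κ * e := by
    intro X hX
    calc _ ≤ _ := hκ _
      _ ≤ κ * (2 * (1 * e)) := by gcongr; exact norm_transpose_mul_add_le he hX
      _ = _ := by ring
  have hV : ∀ {X : Matrix (Fin m) (Fin n) ℝ}, ‖X‖ ≤ 1 →
      ‖valueDeriv A B Q R U X - valueDeriv A B Q R W X‖ ≤
        κ * d * (6 * g + 24 * κ * γ * e) := by
    intro X hX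
    rw [valueDeriv_sub]
    calc _ ≤ _ := norm_add_le _ _
      _ ≤ 2 * κ * (2 * (1 * (d * (3 / 2 * g + 4 * κ * γ * e)))) +
          4 * κ ^ 2 * ((a + 1) * (b * d)) * (2 * (1 * e)) := by
        refine add_le_add ((hT _).1.trans ?_) ((hT _).2.trans ?_)
        · gcongr
          exact norm_transpose_mul_add_le hE hX
        · gcongr
          exact norm_transpose_mul_add_le he hX
      _ = _ := by rw [hγ]; ring
  set v := κ * d * (6 * g + 24 * κ * γ * e) with hv
  have hGW : ‖gradDeriv A B Q R W Y‖ ≤ g + 2 * a * b * κ * e := by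
    calc _ ≤ _ := norm_sub_le _ _
      _ ≤ g * 1 + b * (2 * κ * e) * a :=
        add_le_add (norm_mul_le_of_le hG hY)
          (norm_mul_le_of_le (norm_mul_le_of_le hBt (hVW hY)) ha)
      _ = _ := by ring
  have hGd : ‖gradDeriv A B Q R U Y - gradDeriv A B Q R W Y‖ ≤
      b ^ 2 * (2 * κ * d * (2 * e + g * d)) + γ * v + 2 * κ * e * b ^ 2 * d := by
    rw [gradDeriv_sub]
    calc _ ≤ _ := (norm_add_le _ _).trans (add_le_add_left (norm_sub_le _ _) _)
      _ ≤ b * (2 * κ * d * (2 * e + g * d)) * b + b * v * (a + 1) + b * (2 * κ * e) * (b * d) :=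
        add_le_add (add_le_add (norm_mul_le_of_le (norm_mul_le_of_le hBt hP) hBY)
          (norm_mul_le_of_le (norm_mul_le_of_le hBt (hV hY)) hU1))
          (norm_mul_le_of_le (norm_mul_le_of_le hBt (hVW hY)) hBD)
      _ = _ := by rw [hγ]; ring
  have hHW : ‖hessSource A B Q R W Y Z‖ ≤
      2 * (g + 2 * a * b * κ * e) + 4 * a * b * κ * e := by
    calc _ ≤ _ := (norm_sub_le _ _).trans (add_le_add_right (norm_add_le _ _) _)
      _ ≤ 2 * (1 * (g + 2 * a * b * κ * e)) +
          (b * (2 * κ * e) * a + a * (2 * κ * e) * b) :=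
        add_le_add (norm_transpose_mul_add_le hGW hZ)
          (add_le_add (norm_mul_le_of_le (norm_mul_le_of_le hBYt (hVW hZ)) ha)
            (norm_mul_le_of_le (norm_mul_le_of_le hFat (hVW hZ)) hBY))
      _ = _ := by ring
  have hHd : ‖hessSource A B Q R U Y Z - hessSource A B Q R W Y Z‖ ≤
      2 * (b ^ 2 * (2 * κ * d * (2 * e + g * d)) + γ * v + 2 * κ * e * b ^ 2 * d)
        + 2 * (γ * v) + 4 * κ * e * b ^ 2 * d := by
    rw [hessSource_sub]
    refine (norm_add_le _ _).trans
      ((add_le_add ((norm_sub_le _ _).trans (add_le_add_right (norm_add_le _ _) _))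
        (norm_add_le _ _)).trans ?_)
    refine (add_le_add (add_le_add (norm_transpose_mul_add_le hGd hZ)
      (add_le_add (norm_mul_le_of_le (norm_mul_le_of_le hBYt (hV hZ)) hU1)
        (norm_mul_le_of_le (norm_mul_le_of_le hFt' (hV hZ)) hBY)))
      (add_le_add (norm_mul_le_of_le (norm_mul_le_of_le hBYt (hVW hZ)) hBD)
        (norm_mul_le_of_le (norm_mul_le_of_le hBDt (hVW hZ)) hBY))).trans (le_of_eq ?_)
    rw [hγ]
    ring
  -- The source change is paired with the positive `Σ_U`, using operator norm times trace; the
  -- change of `Σ` is paired with the source at `W`, using the dual perturbation bound.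
  have hsplit : (stateCorr A B D U * hessSource A B Q R U Y Z).trace
      - (stateCorr A B D W * hessSource A B Q R W Y Z).trace =
      ((hessSource A B Q R U Y Z - hessSource A B Q R W Y Z) * stateCorr A B D U).trace
      + ((stateCorr A B D U - stateCorr A B D W) * hessSource A B Q R W Y Z).trace := by
    rw [Matrix.trace_mul_comm _ (stateCorr A B D U), Matrix.mul_sub, Matrix.sub_mul,
      Matrix.trace_sub, Matrix.trace_sub]
    ring
  rw [hsplit]
  set h := 2 * (b ^ 2 * (2 * κ * d * (2 * e + g * d)) + γ * v + 2 * κ * e * b ^ 2 * d)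
        + 2 * (γ * v) + 4 * κ * e * b ^ 2 * d with hh
  have hh0 : 0 ≤ h := (norm_nonneg _).trans hHd
  have hpos : (stateCorr A B D U).PosSemidef := posSemidef_lyap hU.powSummable hM
  calc _ ≤ _ := abs_add_le _ _
    _ ≤ h * (2 * q) + 4 * κ * ((a + 1) * (b * d)) * q *
        (2 * (g + 2 * a * b * κ * e) + 4 * a * b * κ * e) := by
      refine add_le_add ((abs_trace_mul_le _ hpos).trans ?_) ((hcorr _).trans ?_)
      · exact mul_le_mul hHd htr hpos.trace_nonneg hh0
      · gcongr
    _ = q * (2 * h + 4 * κ * γ * d *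
        (2 * (g + 2 * a * b * κ * e) + 4 * a * b * κ * e)) := by rw [hγ]; ring
    _ ≤ q * (64 * κ * γ * d * (g + 4 * κ * γ * e)) := by
      gcongr
      exact hessian_perturbation_arith hκ1 hb0 ha0 hd0 hg0 he0 hbd
    _ = _ := by ring

end HessianBound

/-! ### Bounds at `W` in terms of the cost. -/

section CostBounds

open MeasureTheory

variable {n m : ℕ} {A : Matrix (Fin n) (Fin n) ℝ} {B : Matrix (Fin n) (Fin m) ℝ}
  {Q : Matrix (Fin n) (Fin n) ℝ} {R : Matrix (Fin m) (Fin m) ℝ}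
  {D : Measure (Fin n → ℝ)} {W U : Matrix (Fin m) (Fin n) ℝ}

theorem posSemidef_secondMoment (hD : ∀ i, MemLp (fun x₀ : Fin n → ℝ => x₀ i) 2 D) :
    (secondMoment D).PosSemidef := by
  refine Matrix.PosSemidef.of_dotProduct_mulVec_nonneg ?_ fun x => ?_
  · ext i j
    simp [secondMoment, mul_comm]
  · have h := integral_sum_sum_mul (μ := D) (fun i j => x i * x j)
      fun i j => (hD i).integrable_mul (hD j)
    have h1 : star x ⬝ᵥ secondMoment D *ᵥ x = ∑ i, ∑ j, x i * x j * ∫ y, y i * y j ∂D := by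
      simp only [star_trivial, dotProduct, Matrix.mulVec, secondMoment, Matrix.of_apply,
        Finset.mul_sum]
      exact Finset.sum_congr rfl fun i _ => Finset.sum_congr rfl fun j _ => by ring
    rw [h1, ← h]
    refine integral_nonneg fun y => ?_
    have h2 : ∑ i, ∑ j, x i * x j * (y i * y j) = (∑ i, x i * y i) ^ 2 := by
      rw [sq, Finset.sum_mul_sum]
      exact Finset.sum_congr rfl fun i _ => Finset.sum_congr rfl fun j _ => by ring
    change 0 ≤ ∑ i, ∑ j, x i * x j * (y i * y j)
    rw [h2]
    positivity

theorem sigmaMin_mul_trace_le {Z S : Matrix (Fin n) (Fin n) ℝ} (hZ : Z.PosSemidef)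
    (hS : S.PosSemidef) : sigmaMin Z * S.trace ≤ (Z * S).trace := by
  have h := trace_mul_nonneg (posSemidef_sub_sigmaMin hZ) hS
  rw [Matrix.sub_mul, Matrix.trace_sub, Matrix.smul_mul, Matrix.one_mul, Matrix.trace_smul,
    smul_eq_mul] at h
  linarith

theorem pos_of_mu_pos (hμ : 0 < mu D) : 0 < n := by
  rcases Nat.eq_zero_or_pos n with rfl | h
  · rw [mu, sigmaMin, LinearMap.singularValues_of_finrank_le _ (by simp)] at hμ
    exact absurd hμ (lt_irrefl _)
  · exact h

theorem posSemidef_transpose_mul_mul (hR : R.PosSemidef) (W : Matrix (Fin m) (Fin n) ℝ) :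
    (Wᵀ * R * W).PosSemidef := by
  have := hR.conjTranspose_mul_mul_same W
  rwa [Matrix.conjTranspose_eq_transpose_of_trivial] at this

theorem posSemidef_valueMatrix (hQ : Q.PosSemidef) (hR : R.PosSemidef) (hW : Stabilizing A B W) :
    (valueMatrix A B Q R W).PosSemidef :=
  posSemidef_lyap hW.powSummable.transpose (hQ.add (posSemidef_transpose_mul_mul hR W))

theorem mu_mul_trace_valueMatrix_le (hQ : Q.PosSemidef) (hR : R.PosSemidef)
    (hD : ∀ i, MemLp (fun x₀ : Fin n → ℝ => x₀ i) 2 D) (hW : Stabilizing A B W) :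
    mu D * (valueMatrix A B Q R W).trace ≤ cost A B Q R D W := by
  rw [cost_eq_trace hD hW]
  exact sigmaMin_mul_trace_le (posSemidef_secondMoment hD) (posSemidef_valueMatrix hQ hR hW)

theorem sigmaMin_mul_trace_stateCorr_le (hQ : Q.PosSemidef) (hR : R.PosSemidef)
    (hD : ∀ i, MemLp (fun x₀ : Fin n → ℝ => x₀ i) 2 D) (hW : Stabilizing A B W) :
    sigmaMin Q * (stateCorr A B D W).trace ≤ cost A B Q R D W := by
  have hS : (stateCorr A B D W).PosSemidef :=
    posSemidef_lyap hW.powSummable (posSemidef_secondMoment hD)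
  have h1 := sigmaMin_mul_trace_le hQ hS
  have h2 := trace_mul_nonneg (posSemidef_transpose_mul_mul hR W) hS
  rw [cost_eq_trace hD hW, valueMatrix, ← trace_lyap_mul hW.powSummable, ← stateCorr,
    Matrix.trace_mul_comm, Matrix.add_mul, Matrix.trace_add]
  linarith

/-- By duality `μ tr(lyap Fᵀ 1) ≤ tr(M lyap Fᵀ 1) = tr Σ`, and `tr Σ` is bounded through `Q`. This
yields `κ = c/(μs)`. -/
theorem mu_mul_sigmaMin_mul_trace_le (hQ : Q.PosSemidef) (hR : R.PosSemidef)
    (hD : ∀ i, MemLp (fun x₀ : Fin n → ℝ => x₀ i) 2 D) (hW : Stabilizing A B W) :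
    mu D * sigmaMin Q * (lyap (A - B * W)ᵀ 1).trace ≤ cost A B Q R D W := by
  have hs0 : 0 ≤ sigmaMin Q := LinearMap.singularValues_nonneg _ _
  have h1 := sigmaMin_mul_trace_le (posSemidef_secondMoment hD)
    (posSemidef_lyap hW.powSummable.transpose Matrix.PosSemidef.one)
  rw [← trace_lyap_mul hW.powSummable, Matrix.mul_one, ← stateCorr, ← mu] at h1
  have h2 := sigmaMin_mul_trace_stateCorr_le hQ hR hD hW
  have h3 := mul_le_mul_of_nonneg_left h1 hs0
  linarith

theorem one_le_trace_lyap_one (hn : 0 < n) (hW : Stabilizing A B W) :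
    1 ≤ (lyap (A - B * W)ᵀ 1).trace := by
  have h := (posSemidef_lyap_sub hW.powSummable.transpose Matrix.PosSemidef.one).trace_nonneg
  rw [Matrix.trace_sub, Matrix.trace_one, Fintype.card_fin] at h
  have : (1 : ℝ) ≤ n := by exact_mod_cast hn
  linarith

/-- The Lyapunov equation gives `tr(WᵀRW) ≤ tr P`, so `norm_mul_sq_le` bounds `RW` without any bound
on `W` itself. -/
theorem norm_gradMatrix_le (hQ : Q.PosSemidef) (hR : R.PosSemidef) (hW : Stabilizing A B W)
    {p : ℝ} (hp : (valueMatrix A B Q R W).trace ≤ p) :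
    ‖gradMatrix A B Q R W‖ ≤ Real.sqrt (‖R‖ * p) + ‖B‖ * ‖A - B * W‖ * p := by
  have hS := hQ.add (posSemidef_transpose_mul_mul hR W)
  have h1 := (posSemidef_lyap_sub hW.powSummable.transpose hS).trace_nonneg
  rw [← valueMatrix, Matrix.trace_sub, Matrix.trace_add] at h1
  have h2 : ‖Wᵀ * R * W‖ ≤ p := by
    have := norm_le_trace (posSemidef_transpose_mul_mul hR W)
    linarith [hQ.trace_nonneg]
  have h3 : ‖R * W‖ ≤ Real.sqrt (‖R‖ * p) :=
    Real.le_sqrt_of_sq_le ((norm_mul_sq_le hR W).trans (by gcongr))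
  have h4 : ‖valueMatrix A B Q R W‖ ≤ p :=
    (norm_le_trace (posSemidef_valueMatrix hQ hR hW)).trans hp
  calc _ ≤ _ := norm_sub_le _ _
    _ ≤ Real.sqrt (‖R‖ * p) + ‖B‖ * p * ‖A - B * W‖ :=
      add_le_add h3 (norm_mul_le_of_le (norm_mul_le_of_le (norm_transpose B).le h4) le_rfl)
    _ = _ := by ring

end CostBounds

end LQR

/-! ### Assembly of the theorem. -/

theorem mainTheorem3 {n m : ℕ}
    (A : Matrix (Fin n) (Fin n) ℝ) (B : Matrix (Fin n) (Fin m) ℝ)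
    (Q : Matrix (Fin n) (Fin n) ℝ) (R : Matrix (Fin m) (Fin m) ℝ)
    (hQ : Q.PosDef) (hR : R.PosDef)
    (D : MeasureTheory.Measure (Fin n → ℝ)) [MeasureTheory.IsProbabilityMeasure D]
    (hD : ∀ i, MeasureTheory.MemLp (fun x₀ : Fin n → ℝ => x₀ i) 2 D)
    (hμ : 0 < LQR.mu D)
    (W U : Matrix (Fin m) (Fin n) ℝ)
    (hW : LQR.Stabilizing A B W) (hU : LQR.Stabilizing A B U)
    (hUW : B ≠ 0 → ‖U - W‖ ≤ LQR.delta A B Q R D W) :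
    ContDiffAt ℝ 2 (LQR.cost A B Q R D) W ∧
    ContDiffAt ℝ 2 (LQR.cost A B Q R D) U ∧
    ‖LQR.hessian (LQR.cost A B Q R D) W - LQR.hessian (LQR.cost A B Q R D) U‖ ≤
      LQR.rho (LQR.cost A B Q R D W) (LQR.mu D) (LQR.sigmaMin Q) ‖B‖ ‖R‖ ‖A - B * W‖ *
        ‖W - U‖ := by
  refine ⟨LQR.contDiffAt_cost hD hW, LQR.contDiffAt_cost hD hU, ?_⟩
  have hQt : Qᵀ = Q := by
    rw [← Matrix.conjTranspose_eq_transpose_of_trivial, hQ.isHermitian]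
  have hRt : Rᵀ = R := by
    rw [← Matrix.conjTranspose_eq_transpose_of_trivial, hR.isHermitian]
  have hQ' := hQ.posSemidef
  have hR' := hR.posSemidef
  have hn := LQR.pos_of_mu_pos hμ
  have hs := LQR.sigmaMin_pos hn hQ
  have hbase := LQR.mu_mul_sigmaMin_mul_trace_le hQ' hR' hD hW
  have hvalue := LQR.mu_mul_trace_valueMatrix_le hQ' hR' hD hW
  have hcorr := LQR.sigmaMin_mul_trace_stateCorr_le hQ' hR' hD hW
  have hone := LQR.one_le_trace_lyap_one hn hW
  have hdelta := hUW
  rw [LQR.delta] at hdelta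
  set c := LQR.cost A B Q R D W
  set μ := LQR.mu D
  set s := LQR.sigmaMin Q
  have hμs : 0 < μ * s := mul_pos hμ hs
  have htr : (LQR.lyap (A - B * W)ᵀ 1).trace ≤ c / (μ * s) := by
    rw [le_div_iff₀' hμs]
    exact hbase
  have hκ1 : 1 ≤ c / (μ * s) := hone.trans htr
  have hc : 0 < c := by
    have := (one_le_div hμs).mp hκ1
    linarith
  have hκ : ∀ M, ‖LQR.lyap (A - B * W)ᵀ M‖ ≤ c / (μ * s) * ‖M‖ := fun M =>
    (LQR.norm_lyap_apply_le hW.powSummable.transpose M).trans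
      (mul_le_mul_of_nonneg_right ((LQR.norm_le_trace
        (LQR.posSemidef_lyap hW.powSummable.transpose Matrix.PosSemidef.one)).trans htr)
        (norm_nonneg _))
  have hp : (LQR.valueMatrix A B Q R W).trace ≤ c / μ := by
    rw [le_div_iff₀' hμ]
    exact hvalue
  have hq : (LQR.stateCorr A B D W).trace ≤ c / s := by
    rw [le_div_iff₀' hs]
    exact hcorr
  have hsmall : 4 * (c / (μ * s)) * (‖B‖ * (‖A - B * W‖ + 1)) * ‖U - W‖ ≤ 1 := by
    -- For `B = 0` the radius is infinite and the left side vanishes; otherwise this is the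
    -- definition of `delta` rearranged.
    rcases eq_or_ne B 0 with h0 | h0
    · simp [h0]
    · have h := hdelta h0
      have hb : 0 < ‖B‖ := norm_pos_iff.mpr h0
      have ha : 0 < ‖A - B * W‖ + 1 := by positivity
      rw [le_div_iff₀ (by positivity)] at h
      calc _ = (‖U - W‖ * (4 * c * ‖B‖ * (‖A - B * W‖ + 1))) / (μ * s) := by ring
        _ ≤ (s * μ) / (μ * s) := by gcongr
        _ = 1 := by rw [mul_comm s, div_self hμs.ne']
  have hpv := (LQR.norm_le_trace (LQR.posSemidef_valueMatrix hQ' hR' hW)).trans hp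
  have hmain : ∀ Y Z : Matrix (Fin m) (Fin n) ℝ, ‖Y‖ = 1 → ‖Z‖ = 1 →
      ‖(LQR.hessian (LQR.cost A B Q R D) W - LQR.hessian (LQR.cost A B Q R D) U) Y Z‖ ≤
      LQR.rho c μ s ‖B‖ ‖R‖ ‖A - B * W‖ * ‖W - U‖ := by
    intro Y Z hY hZ
    have h := LQR.abs_trace_hessSource_sub_le hQt hRt (LQR.posSemidef_secondMoment hD) hW hU hκ1 hκ
      le_rfl le_rfl le_rfl le_rfl hpv (LQR.norm_gradMatrix_le hQ' hR' hW hp) hq hsmall hY.le hZ.le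
    rw [sub_apply, sub_apply, LQR.hessian_cost_apply hQt hRt hD hW,
      LQR.hessian_cost_apply hQt hRt hD hU, norm_sub_rev, Real.norm_eq_abs]
    refine h.trans (le_of_eq ?_)
    rw [LQR.rho, norm_sub_rev U W]
    -- The product of `κ = c/(μs)` and the bound `c/s` on `tr Σ` is the prefactor of `rho`.
    have hcs : 64 * (c / (μ * s)) * (c / s) = 64 * (c ^ 2 / (μ * s ^ 2)) := by
      field_simp
    rw [hcs]
  have hρ : 0 ≤ LQR.rho c μ s ‖B‖ ‖R‖ ‖A - B * W‖ * ‖W - U‖ := by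
    rw [LQR.rho]
    positivity
  exact ContinuousLinearMap.opNorm_le_of_unit_norm hρ fun Y hY =>
    ContinuousLinearMap.opNorm_le_of_unit_norm hρ fun Z hZ => hmain Y Z hY hZ
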